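/- Let $(X_i,Y_i)$, $i\ge 1$, be i.i.d. random vectors in $\mathbb R^2$ whose marginal distribution functions $F$ (of $X_1$) and $G$ (of $Y_1$) are continuous, with $\mathbb E X_1^2<\infty$ and $\mathbb E Y_1^2<\infty$, and let $$\gamma=\gamma(X,Y)=\frac{\operatorname{cov}(X_1,G(Y_1))}{\operatorname{cov}(X_1,F(X_1))}$$ be their Gini correlation. Put $$h_1((x_1,y_1),(x_2,y_2))=\tfrac14\left[(x_1-x_2)I(y_1>y_2)+(x_2-x_1)I(y_2>y_1)\right],\qquad h_2((x_1,y_1),(x_2,y_2))=\tfrac14|x_1-x_2|,$$ and $h(\cdot,\cdot;\gamma)=\gamma h_2-h_1$. For $n\ge 3$ let $$U_n(\gamma)=\binom n2^{-1}\sum_{1\le i<j\le n}h((X_i,Y_i),(X_j,Y_j);\gamma),\qquad \hat V_i(\gamma)=nU_n(\gamma)-(n-1)U_{n-1}^{(-i)}(\gamma),\quad 1\le i\le n,$$ where $U_{n-1}^{(-i)}(\gamma)$ is the same functional of the sample with the $i$-th observation deleted, and let $$R(\gamma)=\max\left\{\prod_{i=1}^n(np_i):\ p_i\ge 0,\ \sum_{i=1}^n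 p_i=1,\ \sum_{i=1}^n p_i\hat V_i(\gamma)=0\right\},$$ with $R(\gamma)=0$ if no such $p$ exists and $-2\log 0=+\infty$. Let $g((x,y);\gamma)=\mathbb E\,h((x,y),(X_2,Y_2);\gamma)$ and $\sigma_g^2(\gamma)=\operatorname{Var}\big(g((X_1,Y_1);\gamma)\big)$. If $\sigma_g^2(\gamma)>0$, then $$-2\log R(\gamma)\ \xrightarrow{d}\ \chi^2_1\qquad\text{as } n\to\infty$$ (as random variables in $[-\infty,+\infty]$). -/

import Mathlib

open MeasureTheory ProbabilityTheory Filter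
open scoped ENNReal

noncomputable section

namespace GiniJEL

/-- The Gini correlation `γ(X, Y) = cov(X, G(Y)) / cov(X, F(X))`, where `F` and `G` are the
distribution functions of `X` and `Y`. -/
def giniCorrelation {Ω : Type*} [MeasurableSpace Ω] (P : Measure Ω) (X Y : Ω → ℝ) : ℝ :=
  cov[X, fun ω => cdf (P.map Y) (Y ω); P] / cov[X, fun ω => cdf (P.map X) (X ω); P]

/-- The kernel `h₁(z₁, z₂) = ¼ [(x₁ - x₂) I(y₁ > y₂) + (x₂ - x₁) I(y₂ > y₁)]`. -/
def h₁ (z₁ z₂ : ℝ × ℝ) : ℝ :=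
  1 / 4 * ((z₁.1 - z₂.1) * (if z₁.2 > z₂.2 then 1 else 0)
    + (z₂.1 - z₁.1) * (if z₂.2 > z₁.2 then 1 else 0))

/-- The kernel `h₂(z₁, z₂) = ¼ |x₁ - x₂|`. -/
def h₂ (z₁ z₂ : ℝ × ℝ) : ℝ := 1 / 4 * |z₁.1 - z₂.1|

/-- The kernel `h(z₁, z₂; γ) = h₂(z₁, z₂) γ - h₁(z₁, z₂)`. -/
def h (γ : ℝ) (z₁ z₂ : ℝ × ℝ) : ℝ := h₂ z₁ z₂ * γ - h₁ z₁ z₂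

/-- The `U`-type functional at `γ` of the subsample of `z` with index set `s`: the average of
`h(zᵢ, zⱼ; γ)` over the pairs `i < j` in `s`. -/
def uFunctional {n : ℕ} (γ : ℝ) (z : Fin n → ℝ × ℝ) (s : Finset (Fin n)) : ℝ :=
  ((s.card.choose 2 : ℕ) : ℝ)⁻¹ * ∑ i ∈ s, ∑ j ∈ s with i < j, h γ (z i) (z j)

/-- The jackknife pseudo-values `V̂ᵢ(γ) = n Uₙ(γ) - (n - 1) Uₙ₋₁⁽⁻ⁱ⁾(γ)`. -/
def pseudoValue {n : ℕ} (γ : ℝ) (z : Fin n → ℝ × ℝ) (i : Fin n) : ℝ :=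
  (n : ℝ) * uFunctional γ z Finset.univ
    - ((n : ℝ) - 1) * uFunctional γ z (Finset.univ.erase i)

/-- The probability weights `p` on the sample for which the values `V` have weighted mean zero. -/
def feasible {n : ℕ} (V : Fin n → ℝ) : Set (Fin n → ℝ) :=
  {p | (∀ i, 0 ≤ p i) ∧ ∑ i, p i = 1 ∧ ∑ i, p i * V i = 0}

/-- The empirical likelihood ratio `max {∏ᵢ (n pᵢ) : p ∈ feasible V}` as an element of `[0, ∞]`.
The feasible set is compact, so the supremum is a maximum when that set is nonempty; when it is
empty, the value is `0`. -/
def elRatio {n : ℕ} (V : Fin n → ℝ) : ℝ≥0∞ :=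
  ⨆ p ∈ feasible V, ENNReal.ofReal (∏ i, (n : ℝ) * p i)

/-- The jackknife empirical likelihood ratio `R(γ)` of the sample `z`. -/
def jelRatio {n : ℕ} (γ : ℝ) (z : Fin n → ℝ × ℝ) : ℝ≥0∞ := elRatio (pseudoValue γ z)

/-- The projection `g(z; γ) = 𝔼 h(z, Z; γ)` of the kernel, for an observation `Z`. -/
def proj {Ω : Type*} [MeasurableSpace Ω] (P : Measure Ω) (Z : Ω → ℝ × ℝ) (γ : ℝ) (z : ℝ × ℝ) : ℝ :=
  ∫ ω, h γ z (Z ω) ∂P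

/-- The variance `σ_g²(γ) = Var g(Z; γ)` of the projection. -/
def sigmaSq {Ω : Type*} [MeasurableSpace Ω] (P : Measure Ω) (Z : Ω → ℝ × ℝ) (γ : ℝ) : ℝ :=
  Var[fun ω => proj P Z γ (Z ω); P]

/-- The chi-square distribution with one degree of freedom: the law of the square of a standard
normal random variable. -/
def chiSqOne : Measure ℝ := (gaussianReal 0 1).map (fun x => x ^ 2)

instance : IsProbabilityMeasure chiSqOne :=
  Measure.isProbabilityMeasure_map (by fun_prop)

end GiniJEL

end

/-!
Wilks' theorem for the jackknife empirical likelihood of a `U`-statistic with kernel `h`, whose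
projection is `g z = 𝔼 h(z, Z)`.

*Probability.* The kernel has mean zero at the Gini correlation, because the numerator and the
denominator of `γ` are the means of `h₁` and `h₂` (`integral_sign_kernel_eq_cov`,
`integral_h_eq_zero`). With the degenerate kernel `H(z, w) = h(z, w) - g(z) - g(w)` and its row sums
`Dᵢ = ∑_{j ≠ i} H(Zᵢ, Zⱼ)`, the pseudo-values satisfy the exact identity (`pseudoValue_eq`)
`V̂ᵢ = 2 g(Zᵢ) + 2 Dᵢ / (n - 2) - ∑ₐ Dₐ / ((n - 1)(n - 2))`.
The variables `H(Zᵢ, Zⱼ)`, `i < j`, are orthogonal, so `𝔼 Dᵢ² = O(n)` and `𝔼 (∑ₐ Dₐ)² = O(n²)`.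
Hence the pseudo-values differ from the i.i.d. variables `2 g(Zᵢ)` by errors with mean square
`O(1 / n)`, and the sum of the errors is bounded in mean square. The central limit theorem for the
normalised sum `A = √n · mean V̂`, the law of large numbers for the mean square `s` of the
pseudo-values, with limit `τ = 4 σ_g²`, and `max |V̂ᵢ| = o(√n)` pass from `2 g(Zᵢ)` to `V̂ᵢ`
(`tendstoInDistribution_neg_two_log_elRatio_of_approx`).

*Empirical likelihood.* The expansion `-2 log R = A² / τ + o(1)` needs no Lagrange multiplier. With
`m` the mean of the pseudo-values, weak duality at `l = m / s` gives
`-log R ≥ ∑ log (1 + l V̂ᵢ)`, and the explicit feasible weights `pᵢ = (1 - b (V̂ᵢ - m)) / n` with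
`b = m / (s - m²)` give `-log R ≤ -∑ log (1 - b (V̂ᵢ - m))`. Both bounds are `A² / (2 τ) + o(1)` by
the second-order expansion of the logarithm (`exists_wilks_expansion`). The second bound also shows
that the statistic is finite with probability tending to one, so that the convergence of its
real-valued version carries over to the extended reals.
-/

open scoped Topology

namespace GiniJEL

/-! ### The empirical likelihood ratio of a fixed sample -/

lemma abs_log_one_add_sub_le {ε t : ℝ} (hε : ε ≤ 1 / 2) (ht : |t| ≤ ε) :
    |Real.log (1 + t) - (t - t ^ 2 / 2)| ≤ 2 * ε * t ^ 2 := by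
  have h1 : |-t| < 1 := by rw [abs_neg]; linarith
  have h2 := Real.abs_log_sub_add_sum_range_le h1 2
  simp only [Finset.sum_range_succ, Finset.sum_range_zero, abs_neg] at h2
  have h3 : |t| ^ (2 + 1) / (1 - |t|) ≤ 2 * ε * t ^ 2 := by
    rw [div_le_iff₀ (by linarith), ← sq_abs t]
    have h0 := abs_nonneg t
    have : |t| * |t| ^ 2 ≤ ε * |t| ^ 2 := by gcongr
    have h4 : 0 ≤ |t| ^ 2 * ε * (1 - 2 * |t|) :=
      mul_nonneg (mul_nonneg (sq_nonneg _) (h0.trans ht)) (by linarith)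
    rw [pow_succ' |t| 2]
    linarith
  refine le_trans (le_of_eq ?_) (h2.trans h3)
  congr 1
  norm_num
  ring

/-- Weak duality for empirical likelihood: every `l` that keeps the factors `1 + l Vᵢ` positive
bounds the ratio from above. -/
lemma elRatio_le_of_dual {n : ℕ} (V : Fin n → ℝ) (l : ℝ) (hl : ∀ i, 0 < 1 + l * V i) :
    elRatio V ≤ ENNReal.ofReal (Real.exp (-∑ i, Real.log (1 + l * V i))) := by
  refine iSup₂_le fun p hp => ENNReal.ofReal_le_ofReal ?_
  obtain ⟨h0, h1, h2⟩ := hp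
  -- `x ≤ exp (x - 1)` applied to `x = n pᵢ (1 + l Vᵢ)`, whose sum is `n`
  have key : ∏ i, ((n : ℝ) * p i * (1 + l * V i)) ≤ 1 := by
    calc ∏ i, ((n : ℝ) * p i * (1 + l * V i))
        ≤ ∏ i, Real.exp ((n : ℝ) * p i * (1 + l * V i) - 1) := by
          refine Finset.prod_le_prod (fun i _ => ?_) (fun i _ => ?_)
          · have := h0 i; have := hl i; positivity
          · linarith [Real.add_one_le_exp ((n : ℝ) * p i * (1 + l * V i) - 1)]
      _ = 1 := by
          rw [← Real.exp_sum, Real.exp_eq_one_iff, Finset.sum_sub_distrib]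
          have : ∀ i, (n : ℝ) * p i * (1 + l * V i) = n * p i + n * l * (p i * V i) :=
            fun i => by ring
          simp only [this, Finset.sum_add_distrib, ← Finset.mul_sum, h1, h2]
          simp
  have hpos : 0 < ∏ i, (1 + l * V i) := Finset.prod_pos fun i _ => hl i
  rw [Real.exp_neg, Real.exp_sum, Finset.prod_congr rfl fun i _ => Real.exp_log (hl i),
    ← one_div, le_div_iff₀ hpos, ← Finset.prod_mul_distrib]
  exact key

/-- Upper bound for the likelihood ratio, from the approximate dual optimum `l = m / s`. -/
lemma elRatio_le {n : ℕ} (V : Fin n → ℝ) {m s ε : ℝ}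
    (hm : ∑ i, V i = n * m) (hs : ∑ i, V i ^ 2 = n * s) (hs0 : 0 < s) (hε : ε ≤ 1 / 4)
    (hV : ∀ i, |m / s * V i| ≤ ε) :
    elRatio V ≤ ENNReal.ofReal (Real.exp (-(n * m ^ 2 / s * (1 - 4 * ε)) / 2)) := by
  refine (elRatio_le_of_dual V (m / s) fun i => ?_).trans
    (ENNReal.ofReal_le_ofReal (Real.exp_le_exp.2 ?_))
  · linarith [(abs_le.1 (hV i)).1]
  · have : ∑ i, (m / s * V i - (1 / 2 + 2 * ε) * (m / s * V i) ^ 2)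
        ≤ ∑ i, Real.log (1 + m / s * V i) := by
      refine Finset.sum_le_sum fun i _ => ?_
      have := (abs_le.1 (abs_log_one_add_sub_le (by linarith) (hV i))).1
      linarith
    simp only [Finset.sum_sub_distrib, mul_pow, ← Finset.mul_sum, hm, hs] at this
    have e : m / s * (n * m) - (1 / 2 + 2 * ε) * ((m / s) ^ 2 * (n * s))
        = n * m ^ 2 / s * (1 - 4 * ε) / 2 := by field_simp; ring
    linarith

/-- Lower bound for the likelihood ratio. The weights `pᵢ = (1 - b (Vᵢ - m)) / n` with
`b = m / (s - m²)`, which minimise the Euclidean distance to the uniform weights, are feasible. -/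
lemma le_elRatio {n : ℕ} (hn : 0 < n) (V : Fin n → ℝ) {m s ε : ℝ}
    (hm : ∑ i, V i = n * m) (hs : ∑ i, V i ^ 2 = n * s) (hs0 : 0 < s - m ^ 2) (hε : ε ≤ 1 / 4)
    (hV : ∀ i, |m / (s - m ^ 2) * (V i - m)| ≤ ε) :
    ENNReal.ofReal (Real.exp (-(n * m ^ 2 / (s - m ^ 2) * (1 + 4 * ε)) / 2)) ≤ elRatio V := by
  have hn' : (0 : ℝ) < n := by exact_mod_cast hn
  set b := m / (s - m ^ 2) with hb
  have hb' : b * (s - m ^ 2) = m := by rw [hb]; field_simp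
  have hpos : ∀ i, 0 < 1 + -(b * (V i - m)) := fun i => by
    linarith [(abs_le.1 (hV i)).2]
  set p : Fin n → ℝ := fun i => (n : ℝ)⁻¹ * (1 + -(b * (V i - m))) with hp
  have hsq : ∑ i, (V i - m) ^ 2 = n * (s - m ^ 2) := by
    simp only [sub_sq, Finset.sum_add_distrib, Finset.sum_sub_distrib, hs, mul_assoc,
      ← Finset.mul_sum, ← Finset.sum_mul, hm]
    simp
    ring
  have hfeas : p ∈ feasible V := by
    refine ⟨fun i => ?_, ?_, ?_⟩
    · have := hpos i; positivity
    · simp only [hp, ← Finset.mul_sum, Finset.sum_add_distrib, Finset.sum_neg_distrib,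
        Finset.sum_sub_distrib, hm]
      simp
      field_simp
    · have : ∀ i, p i * V i
          = (n : ℝ)⁻¹ * (V i - b * (V i - m) ^ 2 - b * m * (V i - m)) := fun i => by
        simp only [hp]; ring
      simp only [this, ← Finset.mul_sum, Finset.sum_sub_distrib, hsq, hm]
      simp
      right
      linear_combination (-(n : ℝ)) * hb'
  refine le_trans ?_ (le_iSup₂ (f := fun p (_ : p ∈ feasible V) =>
    ENNReal.ofReal (∏ i, (n : ℝ) * p i)) p hfeas)
  refine ENNReal.ofReal_le_ofReal ?_
  have : ∀ i, (n : ℝ) * p i = Real.exp (Real.log (1 + -(b * (V i - m)))) := fun i => by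
    rw [Real.exp_log (hpos i)]; simp only [hp]; field_simp
  simp only [this, ← Real.exp_sum]
  refine Real.exp_le_exp.2 ?_
  have h1 : ∑ i, (-b * (V i - m) - (1 / 2 + 2 * ε) * b ^ 2 * (V i - m) ^ 2)
      ≤ ∑ i, Real.log (1 + -(b * (V i - m))) := by
    refine Finset.sum_le_sum fun i _ => ?_
    have := (abs_le.1 (abs_log_one_add_sub_le (ε := ε) (t := -(b * (V i - m))) (by linarith)
      (by rw [abs_neg]; exact hV i))).1
    linarith
  refine le_trans (le_of_eq ?_) h1
  simp only [Finset.sum_sub_distrib, ← Finset.mul_sum, hm, hsq]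
  have e : n * m ^ 2 / (s - m ^ 2) = n * (b ^ 2 * (s - m ^ 2)) := by
    rw [hb]; field_simp
  rw [e]
  simp
  ring

lemma exists_neg_two_mul_log_eq {R : ℝ≥0∞} {l u : ℝ}
    (hl : R ≤ ENNReal.ofReal (Real.exp (-l / 2)))
    (hu : ENNReal.ofReal (Real.exp (-u / 2)) ≤ R) :
    ∃ t : ℝ, (-2 : EReal) * ENNReal.log R = t ∧ l ≤ t ∧ t ≤ u := by
  have h0 : R ≠ 0 := (lt_of_lt_of_le (ENNReal.ofReal_pos.2 (Real.exp_pos _)) hu).ne'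
  have ht : R ≠ ⊤ := (lt_of_le_of_lt hl ENNReal.ofReal_lt_top).ne
  have hR : 0 < R.toReal := ENNReal.toReal_pos h0 ht
  refine ⟨-2 * Real.log R.toReal, ?_, ?_, ?_⟩
  · rw [ENNReal.log_pos_real h0 ht, EReal.coe_mul]
    rfl
  · have := ENNReal.toReal_le_of_le_ofReal (Real.exp_pos _).le hl
    have := (Real.log_le_iff_le_exp hR).2 this
    linarith
  · have := (ENNReal.ofReal_le_iff_le_toReal ht).1 hu
    have := (Real.le_log_iff_exp_le hR).2 this
    linarith

/-- Wilks' expansion, uniformly over samples: if the normalised mean `A = √n · mean V` stays in a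
bounded set, the mean square is close to `τ` and no value is of the order of `√n`, then
`-2 log R` is finite and close to `A² / τ`. -/
lemma exists_wilks_expansion {τ K η : ℝ} (hτ : 0 < τ) (hK : 0 < K) (hη : 0 < η) :
    ∃ δ > 0, ∃ N : ℕ, ∀ n ≥ N, ∀ V : Fin n → ℝ, |(√n)⁻¹ * ∑ i, V i| ≤ K →
      |(n : ℝ)⁻¹ * ∑ i, V i ^ 2 - τ| ≤ δ → (∀ i, |V i| ≤ δ * √n) →
      ∃ t : ℝ, (-2 : EReal) * ENNReal.log (elRatio V) = t ∧
        |t - ((√n)⁻¹ * ∑ i, V i) ^ 2 / τ| ≤ η := by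
  -- the two factors that multiply `A²` in the lower and the upper bound for `-2 log R`
  let ψ₁ : ℝ × ℝ × ℝ → ℝ := fun x => x.1⁻¹ * (1 - 4 * (K * x.2.1 * x.1⁻¹))
  let ψ₂ : ℝ × ℝ × ℝ → ℝ := fun x =>
    (x.1 - K ^ 2 * x.2.2)⁻¹ * (1 + 4 * (2 * K * x.2.1 * (x.1 - K ^ 2 * x.2.2)⁻¹))
  have c0 : ContinuousAt (fun x : ℝ × ℝ × ℝ => x.1⁻¹) (τ, 0, 0) :=
    continuousAt_fst.inv₀ (by simpa using hτ.ne')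
  have c00 : ContinuousAt (fun x : ℝ × ℝ × ℝ => x.1 - K ^ 2 * x.2.2) (τ, 0, 0) := by fun_prop
  have c1 : ContinuousAt (fun x : ℝ × ℝ × ℝ => (x.1 - K ^ 2 * x.2.2)⁻¹) (τ, 0, 0) :=
    c00.inv₀ (by simpa using hτ.ne')
  have hc1 : ContinuousAt ψ₁ (τ, 0, 0) := by fun_prop
  have hc2 : ContinuousAt ψ₂ (τ, 0, 0) := by fun_prop
  have e1 : ∀ᶠ x in 𝓝 ((τ, 0, 0) : ℝ × ℝ × ℝ), τ⁻¹ - η / K ^ 2 < ψ₁ x :=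
    hc1.eventually_const_lt (by simp only [ψ₁]; simp; positivity)
  have e2 : ∀ᶠ x in 𝓝 ((τ, 0, 0) : ℝ × ℝ × ℝ), ψ₂ x < τ⁻¹ + η / K ^ 2 :=
    hc2.eventually_lt_const (by simp only [ψ₂]; simp; positivity)
  have e3 : ∀ᶠ x in 𝓝 ((τ, 0, 0) : ℝ × ℝ × ℝ), 0 < x.1 :=
    continuousAt_fst.eventually_const_lt (by simpa using hτ)
  have e4 : ∀ᶠ x in 𝓝 ((τ, 0, 0) : ℝ × ℝ × ℝ), 0 < x.1 - K ^ 2 * x.2.2 :=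
    c00.eventually_const_lt (by simpa using hτ)
  have e5 : ∀ᶠ x in 𝓝 ((τ, 0, 0) : ℝ × ℝ × ℝ), K * x.2.1 * x.1⁻¹ < 1 / 4 :=
    Tendsto.eventually_lt_const (by simp) (ContinuousAt.tendsto (by fun_prop))
  have e6 : ∀ᶠ x in 𝓝 ((τ, 0, 0) : ℝ × ℝ × ℝ),
      2 * K * x.2.1 * (x.1 - K ^ 2 * x.2.2)⁻¹ < 1 / 4 :=
    Tendsto.eventually_lt_const (by simp) (ContinuousAt.tendsto (by fun_prop))
  obtain ⟨ρ, hρ, H⟩ := Metric.eventually_nhds_iff.1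
    (e1.and (e2.and (e3.and (e4.and (e5.and e6)))))
  obtain ⟨N, hN⟩ := exists_nat_gt ρ⁻¹
  refine ⟨ρ / 2, by positivity, N, fun n hn V hA hs hV => ?_⟩
  have hnρ : ρ⁻¹ < n := hN.trans_le (by exact_mod_cast hn)
  have hn' : (0 : ℝ) < n := (inv_pos.2 hρ).trans hnρ
  have hn0 : 0 < n := by exact_mod_cast hn'
  set A := (√n)⁻¹ * ∑ i, V i with hAdef
  set s := (n : ℝ)⁻¹ * ∑ i, V i ^ 2 with hsdef
  set m := (n : ℝ)⁻¹ * ∑ i, V i with hmdef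
  have hsum : ∑ i, V i = n * m := by rw [hmdef]; field_simp
  have hsum2 : ∑ i, V i ^ 2 = n * s := by rw [hsdef]; field_simp
  have hsq : √(n : ℝ) ^ 2 = n := Real.sq_sqrt hn'.le
  have hsq0 : 0 < √(n : ℝ) := Real.sqrt_pos.2 hn'
  have hmA : m = A * (√n)⁻¹ := by
    rw [hmdef, hAdef]; nth_rw 1 [← hsq]; field_simp
  have hnm : n * m ^ 2 = A ^ 2 := by
    rw [hmA]; nth_rw 1 [← hsq]; field_simp
  have hmK : |m| * √n ≤ K := by
    rw [hmA, abs_mul, abs_of_pos (inv_pos.2 hsq0)]; field_simp; exact hA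
  have hA2 : A ^ 2 ≤ K ^ 2 := by rw [← sq_abs A]; gcongr
  have hm2 : m ^ 2 ≤ K ^ 2 * (n : ℝ)⁻¹ := by
    rw [← div_eq_mul_inv, le_div_iff₀ hn']; linarith
  obtain ⟨E1, E2, E3, E4, E5, E6⟩ := @H (s, ρ / 2, (n : ℝ)⁻¹) (by
    simp only [Prod.dist_eq, Real.dist_eq, sub_zero]
    refine max_lt (by linarith) (max_lt ?_ ?_)
    · rw [abs_of_pos (by positivity)]; linarith
    · rw [abs_of_pos (by positivity)]; exact inv_lt_of_inv_lt₀ hρ hnρ)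
  simp only [ψ₁, ψ₂] at E1 E2 E3 E4 E5 E6
  have hmmax : |m| ≤ ρ / 2 * √n := by
    have : |∑ i, V i| ≤ n * (ρ / 2 * √n) := by
      refine (Finset.abs_sum_le_sum_abs _ _).trans ((Finset.sum_le_sum fun i _ => hV i).trans ?_)
      simp
    rw [hsum, abs_mul, abs_of_pos hn'] at this
    exact le_of_mul_le_mul_left this hn'
  have hS : s - K ^ 2 * (n : ℝ)⁻¹ ≤ s - m ^ 2 := by linarith
  have hS0 : 0 < s - m ^ 2 := E4.trans_le hS
  have hSinv : (s - m ^ 2)⁻¹ ≤ (s - K ^ 2 * (n : ℝ)⁻¹)⁻¹ := inv_anti₀ E4 hS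
  have B1 := elRatio_le V hsum hsum2 E3 E5.le (fun i => by
    rw [abs_mul, abs_div, abs_of_pos E3, div_eq_mul_inv]
    calc |m| * s⁻¹ * |V i| ≤ |m| * s⁻¹ * (ρ / 2 * √n) := by gcongr; exact hV i
      _ = (|m| * √n) * (ρ / 2) * s⁻¹ := by ring
      _ ≤ _ := by gcongr)
  have B2 := le_elRatio hn0 V hsum hsum2 hS0 E6.le (fun i => by
    rw [abs_mul, abs_div, abs_of_pos hS0, div_eq_mul_inv]
    have : |V i - m| ≤ 2 * (ρ / 2 * √n) := by
      linarith [abs_sub (V i) m, hV i]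
    calc |m| * (s - m ^ 2)⁻¹ * |V i - m|
        ≤ |m| * (s - K ^ 2 * (n : ℝ)⁻¹)⁻¹ * (2 * (ρ / 2 * √n)) := by gcongr
      _ = 2 * (|m| * √n) * (ρ / 2) * (s - K ^ 2 * (n : ℝ)⁻¹)⁻¹ := by ring
      _ ≤ _ := by gcongr)
  obtain ⟨t, ht, h1, h2⟩ := exists_neg_two_mul_log_eq B1 B2
  refine ⟨t, ht, ?_⟩
  rw [hnm, div_eq_mul_inv] at h1 h2
  have hKη : ∀ x ≤ η / K ^ 2, A ^ 2 * x ≤ η := fun x hx => by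
    calc A ^ 2 * x ≤ A ^ 2 * (η / K ^ 2) := by gcongr
      _ ≤ K ^ 2 * (η / K ^ 2) := by gcongr
      _ = η := by field_simp
  rw [div_eq_mul_inv, abs_le]
  constructor
  · have := hKη (τ⁻¹ - s⁻¹ * (1 - 4 * (K * (ρ / 2) * s⁻¹))) (by linarith)
    linarith
  · have h3 : A ^ 2 * (s - m ^ 2)⁻¹ *
          (1 + 4 * (2 * K * (ρ / 2) * (s - K ^ 2 * (n : ℝ)⁻¹)⁻¹))
        ≤ A ^ 2 * (s - K ^ 2 * (n : ℝ)⁻¹)⁻¹ *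
          (1 + 4 * (2 * K * (ρ / 2) * (s - K ^ 2 * (n : ℝ)⁻¹)⁻¹)) := by gcongr
    have := hKη ((s - K ^ 2 * (n : ℝ)⁻¹)⁻¹ *
      (1 + 4 * (2 * K * (ρ / 2) * (s - K ^ 2 * (n : ℝ)⁻¹)⁻¹)) - τ⁻¹) (by linarith)
    linarith

/-- Feasibility is a closed condition on `(V, p)` with `p` in the compact simplex, so
`{V | R(V) > c}` is a countable union of projections of closed sets along a compact space. -/
lemma measurable_elRatio {n : ℕ} : Measurable (elRatio (n := n)) := by
  refine measurable_of_Ioi fun c => ?_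
  let C : ℝ≥0∞ → Set ((Fin n → ℝ) × stdSimplex ℝ (Fin n)) := fun q =>
    {x | ∑ i, x.2.1 i * x.1 i = 0 ∧ q ≤ ENNReal.ofReal (∏ i, (n : ℝ) * x.2.1 i)}
  have hp : ∀ i, Continuous fun x : (Fin n → ℝ) × stdSimplex ℝ (Fin n) => x.2.1 i := fun i =>
    (continuous_apply i).comp (continuous_subtype_val.comp continuous_snd)
  have hC : ∀ q, IsClosed (Prod.fst '' C q) := fun q => by
    refine isClosedMap_fst_of_compactSpace _ (IsClosed.inter ?_ ?_)
    · exact isClosed_eq (continuous_finsetSum _ fun i _ => (hp i).mul (by fun_prop)) continuous_const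
    · exact isClosed_le continuous_const (ENNReal.continuous_ofReal.comp
        (continuous_finsetProd _ fun i _ => continuous_const.mul (hp i)))
  have : elRatio (n := n) ⁻¹' Set.Ioi c
      = ⋃ q : ℚ, ⋃ (_ : c < ENNReal.ofReal q), Prod.fst '' C (ENNReal.ofReal q) := by
    ext V
    simp only [Set.mem_preimage, Set.mem_Ioi, Set.mem_iUnion, Set.mem_image, elRatio, lt_iSup_iff]
    constructor
    · rintro ⟨p, hp, hc⟩
      obtain ⟨q, -, hcq, hq⟩ := ENNReal.lt_iff_exists_rat_btwn.1 hc
      exact ⟨q, hcq, (V, ⟨p, hp.1, hp.2.1⟩), ⟨hp.2.2, hq.le⟩, rfl⟩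
    · rintro ⟨q, hcq, ⟨V', p⟩, ⟨h1, h2⟩, rfl⟩
      exact ⟨p.1, ⟨p.2.1, p.2.2, h1⟩, hcq.trans_le h2⟩
  rw [this]
  exact MeasurableSet.iUnion fun q => MeasurableSet.iUnion fun _ => (hC _).measurableSet

/-! ### Wilks' theorem for a random sample -/

/-- Convergence in distribution is not affected by changes on events of vanishing probability. -/
lemma tendstoInDistribution_of_tendsto_measure_ne {Ω Ω' E : Type*} [MeasurableSpace Ω]
    [MeasurableSpace Ω'] [TopologicalSpace E] [MeasurableSpace E] [OpensMeasurableSpace E]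
    {P : Measure Ω} [IsProbabilityMeasure P] {P' : Measure Ω'} [IsProbabilityMeasure P']
    {X Y : ℕ → Ω → E} {Z : Ω' → E}
    (hX : TendstoInDistribution X atTop Z (fun _ => P) P') (hY : ∀ n, AEMeasurable (Y n) P)
    (h : Tendsto (fun n => P {ω | X n ω ≠ Y n ω}) atTop (𝓝 0)) :
    TendstoInDistribution Y atTop Z (fun _ => P) P' := by
  refine ⟨hY, hX.aemeasurable_limit, ?_⟩
  have hXm := hX.forall_aemeasurable
  refine ProbabilityMeasure.tendsto_iff_forall_integral_tendsto.2 fun f => ?_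
  have h2 := ProbabilityMeasure.tendsto_iff_forall_integral_tendsto.1 hX.tendsto f
  have hint : ∀ {W : Ω → E}, AEMeasurable W P → Integrable (fun ω => f (W ω)) P := fun hW =>
    Integrable.of_bound (f.continuous.measurable.comp_aemeasurable hW).aestronglyMeasurable ‖f‖
      (ae_of_all _ fun _ => f.norm_coe_le_norm _)
  have hmap : ∀ {W : Ω → E}, AEMeasurable W P →
      ∫ x, f x ∂(P.map W) = ∫ ω, f (W ω) ∂P := fun hW =>
    integral_map hW f.continuous.measurable.aestronglyMeasurable
  have h3 : Tendsto (fun n => ∫ ω, f (Y n ω) ∂P - ∫ ω, f (X n ω) ∂P) atTop (𝓝 0) := by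
    have h4 : Tendsto (fun n => 2 * ‖f‖ * P.real {ω | X n ω ≠ Y n ω}) atTop (𝓝 0) := by
      have := ((ENNReal.tendsto_toReal ENNReal.zero_ne_top).comp h).const_mul (2 * ‖f‖)
      simpa [Measure.real, Function.comp_def] using this
    refine squeeze_zero_norm (fun n => ?_) h4
    rw [← integral_sub (hint (hY n)) (hint (hXm n)),
      ← setIntegral_eq_integral_of_forall_compl_eq_zero (s := {ω | X n ω ≠ Y n ω})]
    · refine norm_setIntegral_le_of_norm_le_const (measure_lt_top _ _) fun ω _ => ?_
      refine (norm_sub_le _ _).trans ?_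
      linarith [f.norm_coe_le_norm (Y n ω), f.norm_coe_le_norm (X n ω)]
    · intro ω hω
      simp only [Set.mem_ofPred_eq, not_not] at hω
      simp [hω]
  have h5 := h2.add h3
  simp only [add_zero] at h5
  refine h5.congr fun n => ?_
  simp only [ProbabilityMeasure.coe_mk]
  rw [hmap (hXm n), hmap (hY n)]
  ring

/-- Wilks' theorem for triangular arrays: the statistic `-2 log R` has the limit law of `A² / τ`,
where `A` is the normalised sum, as soon as `A` is tight and convergent in distribution, the mean
square converges in probability to `τ`, and the largest value is negligible against `√n`. -/
theorem tendstoInDistribution_neg_two_log_elRatio {Ω Ω' : Type*} [MeasurableSpace Ω]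
    [MeasurableSpace Ω'] {P : Measure Ω} [IsProbabilityMeasure P]
    {P' : Measure Ω'} [IsProbabilityMeasure P'] {V : (n : ℕ) → Ω → Fin n → ℝ} {Z : Ω' → ℝ} {τ : ℝ}
    (hτ : 0 < τ) (hV : ∀ n, AEMeasurable (V n) P)
    (hA : TendstoInDistribution (fun (n : ℕ) ω => (√n)⁻¹ * ∑ i, V n ω i) atTop Z
      (fun _ => P) P')
    (htight : ∀ ε > 0, ∃ K : ℝ, 0 < K ∧
      ∀ᶠ n : ℕ in atTop, P {ω | K < |(√n)⁻¹ * ∑ i, V n ω i|} ≤ ε)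
    (hs : TendstoInMeasure P (fun (n : ℕ) ω => (n : ℝ)⁻¹ * ∑ i, V n ω i ^ 2) atTop fun _ => τ)
    (hmax : ∀ δ > 0, Tendsto (fun n : ℕ => P {ω | ∃ i, δ * √n < |V n ω i|}) atTop (𝓝 0)) :
    TendstoInDistribution (fun n ω => (-2 : EReal) * ENNReal.log (elRatio (V n ω))) atTop
      (fun x => ((Z x ^ 2 / τ : ℝ) : EReal)) (fun _ => P) P' := by
  set A : ℕ → Ω → ℝ := fun n ω => (√n)⁻¹ * ∑ i, V n ω i
  set T : ℕ → Ω → EReal := fun n ω => (-2 : EReal) * ENNReal.log (elRatio (V n ω)) with hTdef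
  have hT : ∀ n, AEMeasurable (T n) P := fun n => by
    have : Measurable fun v : Fin n → ℝ => (-2 : EReal) * ENNReal.log (elRatio v) :=
      measurable_const.mul measurable_elRatio.ennreal_log
    exact this.comp_aemeasurable (hV n)
  have hbad : ∀ η > 0, Tendsto
      (fun n => P {ω | ¬ ∃ t : ℝ, T n ω = t ∧ |t - A n ω ^ 2 / τ| ≤ η}) atTop (𝓝 0) := by
    intro η hη
    rw [ENNReal.tendsto_nhds_zero]
    intro ε hε
    have hε3 : 0 < ε / 3 := ENNReal.div_pos hε.ne' (by simp)
    obtain ⟨K, hK, hKP⟩ := htight (ε / 3) hε3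
    obtain ⟨δ, hδ, N, hN⟩ := exists_wilks_expansion hτ hK hη
    have e1 := ENNReal.tendsto_nhds_zero.1 (hmax δ hδ) (ε / 3) hε3
    have e2 := ENNReal.tendsto_nhds_zero.1 (tendstoInMeasure_iff_norm.1 hs δ hδ) (ε / 3) hε3
    filter_upwards [hKP, e1, e2, eventually_ge_atTop N] with n h1 h2 h3 h4
    have hsub : {ω | ¬ ∃ t : ℝ, T n ω = t ∧ |t - A n ω ^ 2 / τ| ≤ η} ⊆
        {ω | K < |A n ω|} ∪ {ω | ∃ i, δ * √n < |V n ω i|} ∪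
          {ω | δ ≤ ‖(n : ℝ)⁻¹ * ∑ i, V n ω i ^ 2 - τ‖} := by
      intro ω hω
      by_contra hc
      simp only [Set.mem_union, Set.mem_ofPred_eq, not_or, not_lt, not_exists, not_le] at hc
      exact hω (hN n h4 (V n ω) hc.1.1 hc.2.le hc.1.2)
    calc _ ≤ _ := measure_mono hsub
      _ ≤ ε / 3 + ε / 3 + ε / 3 := by
        refine (measure_union_le _ _).trans ?_
        gcongr
        exact (measure_union_le _ _).trans (by gcongr)
      _ = ε := ENNReal.add_thirds ε
  have hAsq : TendstoInDistribution (fun n ω => A n ω ^ 2 / τ) atTop (fun x => Z x ^ 2 / τ)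
      (fun _ => P) P' :=
    hA.continuous_comp (g := fun x : ℝ => x ^ 2 / τ) (by fun_prop)
  have hreal : TendstoInDistribution (fun n ω => (T n ω).toReal) atTop (fun x => Z x ^ 2 / τ)
      (fun _ => P) P' := by
    refine tendstoInDistribution_of_tendstoInMeasure_sub _ _ hAsq ?_
      fun n => (hT n).ereal_toReal
    rw [tendstoInMeasure_iff_norm]
    intro η hη
    refine tendsto_of_tendsto_of_tendsto_of_le_of_le tendsto_const_nhds
      (hbad (η / 2) (by positivity)) (fun _ => zero_le) fun n => measure_mono ?_
    rintro ω hω ⟨t, ht, hle⟩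
    simp only [Set.mem_ofPred_eq, Pi.sub_apply, Pi.zero_apply, sub_zero, ht, EReal.toReal_coe,
      Real.norm_eq_abs] at hω
    linarith
  refine tendstoInDistribution_of_tendsto_measure_ne
    (hreal.continuous_comp (g := Real.toEReal) continuous_coe_real_ereal) hT ?_
  refine tendsto_of_tendsto_of_tendsto_of_le_of_le tendsto_const_nhds
    (hbad 1 one_pos) (fun _ => zero_le) fun n => measure_mono ?_
  rintro ω hω ⟨t, ht, -⟩
  simp [ht] at hω

/-! ### Samples close to an i.i.d. sample -/

section Perturbation

variable {Ω : Type*} [MeasurableSpace Ω] {P : Measure Ω} [IsProbabilityMeasure P]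

lemma measure_le_ofReal_integral_div {f : Ω → ℝ} (h0 : ∀ ω, 0 ≤ f ω) (hf : Integrable f P)
    {δ : ℝ} (hδ : 0 < δ) : P {ω | δ ≤ f ω} ≤ ENNReal.ofReal ((∫ ω, f ω ∂P) / δ) := by
  rw [← ofReal_measureReal]
  refine ENNReal.ofReal_le_ofReal ?_
  rw [le_div_iff₀ hδ, mul_comm]
  exact mul_meas_ge_le_integral_of_nonneg (ae_of_all _ h0) hf δ

lemma tendstoInMeasure_zero_of_integral_le {f u : ℕ → Ω → ℝ} {c : ℕ → ℝ}
    (hfu : ∀ n ω, |f n ω| ≤ u n ω) (hu : ∀ n, Integrable (u n) P)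
    (hc : ∀ᶠ n in atTop, ∫ ω, u n ω ∂P ≤ c n) (hc0 : Tendsto c atTop (𝓝 0)) :
    TendstoInMeasure P f atTop 0 := by
  rw [tendstoInMeasure_iff_norm]
  intro δ hδ
  have hlim : Tendsto (fun n => ENNReal.ofReal (c n / δ)) atTop (𝓝 0) := by
    simpa using ENNReal.tendsto_ofReal (hc0.div_const δ)
  refine tendsto_of_tendsto_of_tendsto_of_le_of_le' tendsto_const_nhds hlim
    (.of_forall fun _ => zero_le) ?_
  filter_upwards [hc] with n hn
  calc _ ≤ P {ω | δ ≤ u n ω} := measure_mono fun ω hω => by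
        simp only [Pi.zero_apply, sub_zero, Real.norm_eq_abs, Set.mem_ofPred_eq] at hω
        exact hω.trans (hfu n ω)
    _ ≤ _ := measure_le_ofReal_integral_div (fun ω => (abs_nonneg _).trans (hfu n ω)) (hu n) hδ
    _ ≤ _ := ENNReal.ofReal_le_ofReal (by gcongr)

lemma tendstoInMeasure_zero_of_integral_sq_le {f : ℕ → Ω → ℝ} {c : ℕ → ℝ}
    (hf : ∀ n, MemLp (f n) 2 P) (hc : ∀ᶠ n in atTop, ∫ ω, f n ω ^ 2 ∂P ≤ c n)
    (hc0 : Tendsto c atTop (𝓝 0)) : TendstoInMeasure P f atTop 0 := by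
  have h := tendstoInMeasure_zero_of_integral_le (f := fun n ω => f n ω ^ 2)
    (fun n ω => (abs_of_nonneg (sq_nonneg _)).le) (fun n => (hf n).integrable_sq) hc hc0
  rw [tendstoInMeasure_iff_norm] at h ⊢
  intro δ hδ
  refine (h (δ ^ 2) (by positivity)).congr fun n => ?_
  congr 1
  ext ω
  simp only [Pi.zero_apply, sub_zero, norm_pow, Set.mem_ofPred_eq]
  exact sq_le_sq₀ hδ.le (norm_nonneg _)

/-- The maximum of `n` square-integrable identically distributed variables is `o(√n)` in
probability. -/
lemma tendsto_measure_exists_lt_abs {W : ℕ → Ω → ℝ}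
    (hid : ∀ i, IdentDistrib (W i) (W 0) P P) (hL2 : MemLp (W 0) 2 P) {δ : ℝ} (hδ : 0 < δ) :
    Tendsto (fun n : ℕ => P {ω | ∃ i : Fin n, δ * √n < |W i ω|}) atTop (𝓝 0) := by
  -- the truncated squares have vanishing mean
  let F : ℕ → ℝ → ℝ := fun n x => if δ ^ 2 * n ≤ x ^ 2 then x ^ 2 else 0
  have hFm : ∀ n, Measurable (F n) := fun n =>
    Measurable.ite (measurableSet_le measurable_const (by fun_prop)) (by fun_prop)
      measurable_const
  have hF0 : ∀ n x, 0 ≤ F n x := fun n x => by simp only [F]; split_ifs <;> positivity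
  have hFle : ∀ n x, F n x ≤ x ^ 2 := fun n x => by
    simp only [F]; split_ifs; exacts [le_rfl, sq_nonneg x]
  have hW := (hid 0).aemeasurable_fst
  have hFi : ∀ n, Integrable (fun ω => F n (W 0 ω)) P := fun n =>
    hL2.integrable_sq.mono' ((hFm n).comp_aemeasurable hW).aestronglyMeasurable
      (ae_of_all _ fun ω => by rw [Real.norm_of_nonneg (hF0 _ _)]; exact hFle _ _)
  have hlim : Tendsto (fun n => ∫ ω, F n (W 0 ω) ∂P) atTop (𝓝 0) := by
    rw [← integral_zero Ω ℝ (μ := P)]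
    refine tendsto_integral_of_dominated_convergence (fun ω => W 0 ω ^ 2)
      (fun n => (hFi n).aestronglyMeasurable) hL2.integrable_sq
      (fun n => ae_of_all _ fun ω => by rw [Real.norm_of_nonneg (hF0 _ _)]; exact hFle _ _)
      (ae_of_all _ fun ω => tendsto_const_nhds.congr' ?_)
    have : Tendsto (fun n : ℕ => δ ^ 2 * (n : ℝ)) atTop atTop :=
      tendsto_natCast_atTop_atTop.const_mul_atTop (by positivity)
    filter_upwards [this.eventually_gt_atTop (W 0 ω ^ 2)] with n hn
    simp [F, not_le.2 hn]
  have hlim' : Tendsto (fun n => ENNReal.ofReal ((∫ ω, F n (W 0 ω) ∂P) / δ ^ 2)) atTop (𝓝 0) := by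
    simpa using ENNReal.tendsto_ofReal (hlim.div_const (δ ^ 2))
  refine tendsto_of_tendsto_of_tendsto_of_le_of_le' tendsto_const_nhds hlim'
    (.of_forall fun _ => zero_le) ?_
  filter_upwards [eventually_gt_atTop 0] with n hn
  have hn' : (0 : ℝ) < n := by exact_mod_cast hn
  have hone : ∀ i : Fin n, P {ω | δ * √n < |W i ω|}
      ≤ ENNReal.ofReal ((∫ ω, F n (W 0 ω) ∂P) / (δ ^ 2 * n)) := fun i => by
    have hS : MeasurableSet {x : ℝ | δ * √n < |x|} :=
      measurableSet_lt measurable_const (by fun_prop)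
    calc P {ω | δ * √n < |W i ω|} = P {ω | δ * √n < |W 0 ω|} := (hid i).measure_mem_eq hS
      _ ≤ P {ω | δ ^ 2 * n ≤ F n (W 0 ω)} := measure_mono fun ω hω => by
          simp only [Set.mem_ofPred_eq] at hω ⊢
          have : δ ^ 2 * n ≤ W 0 ω ^ 2 := by
            rw [← sq_abs (W 0 ω), ← Real.sq_sqrt hn'.le, ← mul_pow]
            gcongr
          simp only [F, if_pos this, this]
      _ ≤ _ := measure_le_ofReal_integral_div (fun _ => hF0 _ _) (hFi n) (by positivity)
  calc P {ω | ∃ i : Fin n, δ * √n < |W i ω|}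
      = P (⋃ i : Fin n, {ω | δ * √n < |W i ω|}) := by congr 1; ext; simp
    _ ≤ ∑ i : Fin n, P {ω | δ * √n < |W i ω|} := measure_iUnion_fintype_le _ _
    _ ≤ ∑ i : Fin n, ENNReal.ofReal ((∫ ω, F n (W 0 ω) ∂P) / (δ ^ 2 * n)) :=
        Finset.sum_le_sum fun i _ => hone i
    _ = _ := by
        rw [Finset.sum_const, nsmul_eq_mul, Finset.card_univ, Fintype.card_fin,
          ← ENNReal.ofReal_natCast, ← ENNReal.ofReal_mul hn'.le]
        congr 1
        field_simp

/-- Remainders with mean squares of order `1 / n` are uniformly `o(√n)` in probability. -/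
lemma tendsto_measure_exists_lt_abs_of_integral_sq_le {R : (n : ℕ) → Ω → Fin n → ℝ} {B : ℝ}
    (hR : ∀ n i, MemLp (fun ω => R n ω i) 2 P)
    (hB : ∀ᶠ n in atTop, ∀ i : Fin n, ∫ ω, R n ω i ^ 2 ∂P ≤ B / n) {δ : ℝ} (hδ : 0 < δ) :
    Tendsto (fun n : ℕ => P {ω | ∃ i, δ * √n < |R n ω i|}) atTop (𝓝 0) := by
  have hlim : Tendsto (fun n : ℕ => ENNReal.ofReal (B / δ ^ 2 / n)) atTop (𝓝 0) := by
    simpa using ENNReal.tendsto_ofReal (tendsto_const_div_atTop_nhds_zero_nat (B / δ ^ 2))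
  refine tendsto_of_tendsto_of_tendsto_of_le_of_le' tendsto_const_nhds hlim
    (.of_forall fun _ => zero_le) ?_
  filter_upwards [eventually_gt_atTop 0, hB] with n hn hBn
  have hn' : (0 : ℝ) < n := by exact_mod_cast hn
  have hone : ∀ i : Fin n, P {ω | δ * √n < |R n ω i|}
      ≤ ENNReal.ofReal (B / n / (δ ^ 2 * n)) := fun i => by
    calc P {ω | δ * √n < |R n ω i|} ≤ P {ω | δ ^ 2 * n ≤ R n ω i ^ 2} :=
          measure_mono fun ω hω => by
            simp only [Set.mem_ofPred_eq] at hω ⊢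
            rw [← sq_abs (R n ω i), ← Real.sq_sqrt hn'.le, ← mul_pow]
            gcongr
      _ ≤ _ := measure_le_ofReal_integral_div (fun _ => sq_nonneg _) (hR n i).integrable_sq
          (by positivity)
      _ ≤ _ := ENNReal.ofReal_le_ofReal (by gcongr; exact hBn i)
  calc P {ω | ∃ i, δ * √n < |R n ω i|}
      = P (⋃ i : Fin n, {ω | δ * √n < |R n ω i|}) := by congr 1; ext; simp
    _ ≤ ∑ i : Fin n, P {ω | δ * √n < |R n ω i|} := measure_iUnion_fintype_le _ _
    _ ≤ ∑ i : Fin n, ENNReal.ofReal (B / n / (δ ^ 2 * n)) :=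
        Finset.sum_le_sum fun i _ => hone i
    _ = _ := by
        rw [Finset.sum_const, nsmul_eq_mul, Finset.card_univ, Fintype.card_fin,
          ← ENNReal.ofReal_natCast, ← ENNReal.ofReal_mul hn'.le]
        congr 1
        field_simp

/-- A real sequence that converges in distribution is tight. -/
lemma exists_eventually_measure_lt_abs_le {Ω' : Type*} [MeasurableSpace Ω'] {P' : Measure Ω'}
    [IsProbabilityMeasure P'] {A : ℕ → Ω → ℝ} {Z : Ω' → ℝ}
    (hA : TendstoInDistribution A atTop Z (fun _ => P) P') {ε : ℝ≥0∞} (hε : 0 < ε) :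
    ∃ K : ℝ, 0 < K ∧ ∀ᶠ n in atTop, P {ω | K < |A n ω|} ≤ ε := by
  have hZ := hA.aemeasurable_limit
  let S : ℝ → Set ℝ := fun K => {x | K ≤ |x|}
  have hSc : ∀ K, IsClosed (S K) := fun K => isClosed_le continuous_const continuous_abs
  have := Measure.isProbabilityMeasure_map hZ
  have hlim : Tendsto (P'.map Z ∘ S) atTop (𝓝 (P'.map Z (⋂ K, S K))) :=
    tendsto_measure_iInter_atTop (fun K => (hSc K).measurableSet.nullMeasurableSet)
      (fun K L hKL x hx => le_trans hKL hx) ⟨0, measure_ne_top _ _⟩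
  have hempty : (⋂ K, S K) = ∅ := by
    ext x
    simp only [S, Set.mem_iInter, Set.mem_ofPred_eq, Set.mem_empty_iff_false, iff_false, not_forall,
      not_le]
    exact ⟨|x| + 1, by linarith⟩
  rw [hempty, measure_empty] at hlim
  obtain ⟨K, hK, hK0⟩ := ((hlim.eventually_lt_const hε).and (eventually_gt_atTop 0)).exists
  refine ⟨K, hK0, ?_⟩
  have h := (ProbabilityMeasure.limsup_measure_closed_le_of_tendsto hA.tendsto (hSc K)).trans_lt hK
  filter_upwards [eventually_lt_of_limsup_lt h] with n hn
  simp only [ProbabilityMeasure.coe_mk] at hn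
  rw [Measure.map_apply_of_aemeasurable (hA.forall_aemeasurable n) (hSc K).measurableSet] at hn
  refine (measure_mono (t := A n ⁻¹' S K) fun ω hω => ?_).trans hn.le
  simp only [S, Set.mem_preimage, Set.mem_ofPred_eq] at hω ⊢
  exact hω.le

/-- Mean squares of a sample whose distance to an i.i.d. sample is of order `1 / √n` obey the law
of large numbers of the i.i.d. sample. -/
lemma tendstoInMeasure_mean_sq {W : ℕ → Ω → ℝ} {V : (n : ℕ) → Ω → Fin n → ℝ} {τ B : ℝ}
    (hind : iIndepFun W P) (hid : ∀ i, IdentDistrib (W i) (W 0) P P) (hL2 : MemLp (W 0) 2 P)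
    (hvar : ∫ ω, W 0 ω ^ 2 ∂P = τ) (hV : ∀ n i, MemLp (fun ω => V n ω i) 2 P)
    (hB : ∀ᶠ n in atTop, ∀ i : Fin n, ∫ ω, (V n ω i - W i ω) ^ 2 ∂P ≤ B / n) :
    TendstoInMeasure P (fun (n : ℕ) ω => (n : ℝ)⁻¹ * ∑ i, V n ω i ^ 2) atTop fun _ => τ := by
  have hWL2 : ∀ i, MemLp (W i) 2 P := fun i => (hid i).memLp_iff.2 hL2
  have hWi : ∀ i, ∫ ω, W i ω ^ 2 ∂P = τ := fun i => hvar ▸ (hid i).sq.integral_eq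
  -- the mean squares of the i.i.d. sample
  have h1 : TendstoInMeasure P (fun (n : ℕ) ω => (n : ℝ)⁻¹ * ∑ i : Fin n, W i ω ^ 2) atTop
      fun _ => τ := by
    refine tendstoInMeasure_of_tendsto_ae (fun n => ?_) ?_
    · exact ((integrable_finsetSum _ fun (i : Fin n) _ =>
        (hWL2 i).integrable_sq).const_mul _).aestronglyMeasurable
    · have := strong_law_ae_real (fun i ω => W i ω ^ 2) hL2.integrable_sq
        (fun i j hij => (hind.indepFun hij).comp (measurable_id.pow_const 2)
          (measurable_id.pow_const 2)) (fun i => (hid i).sq)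
      filter_upwards [this] with ω hω
      rw [hvar] at hω
      refine hω.congr fun n => ?_
      rw [Fin.sum_univ_eq_sum_range (fun i => W i ω ^ 2) n]
      ring
  -- the difference, by `2|ab| ≤ a²/√n + √n b²`
  have h2 : TendstoInMeasure P (fun (n : ℕ) ω => (n : ℝ)⁻¹ * ∑ i, V n ω i ^ 2
      - (n : ℝ)⁻¹ * ∑ i : Fin n, W i ω ^ 2) atTop 0 := by
    refine tendstoInMeasure_zero_of_integral_le
      (u := fun n ω => (n : ℝ)⁻¹ * ∑ i : Fin n,
        ((√n)⁻¹ * W i ω ^ 2 + (√n + 1) * (V n ω i - W i ω) ^ 2))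
      (c := fun n => (√n)⁻¹ * τ + ((√n)⁻¹ + (n : ℝ)⁻¹) * B)
      (fun n ω => ?_) (fun n => ?_) ?_ ?_
    · rw [← mul_sub, ← Finset.sum_sub_distrib, abs_mul, abs_of_nonneg (by positivity)]
      gcongr
      refine (Finset.abs_sum_le_sum_abs _ _).trans (Finset.sum_le_sum fun i _ => ?_)
      have hn : (0 : ℝ) < n := by exact_mod_cast i.pos
      have hs : 0 < √(n : ℝ) := Real.sqrt_pos.2 hn
      set a := W i ω
      set b := V n ω i - W i ω
      have e : V n ω i ^ 2 - a ^ 2 = 2 * a * b + b ^ 2 := by simp only [a, b]; ring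
      have h1 : 0 ≤ (√n)⁻¹ * (a - √n * b) ^ 2 := by positivity
      have h2 : 0 ≤ (√n)⁻¹ * (a + √n * b) ^ 2 := by positivity
      have e1 : (√n)⁻¹ * (a - √n * b) ^ 2 = (√n)⁻¹ * a ^ 2 + √n * b ^ 2 - 2 * a * b := by
        field_simp; ring
      have e2 : (√n)⁻¹ * (a + √n * b) ^ 2 = (√n)⁻¹ * a ^ 2 + √n * b ^ 2 + 2 * a * b := by
        field_simp; ring
      rw [e, abs_le]
      constructor <;> nlinarith [sq_nonneg b]
    · exact (integrable_finsetSum _ fun (i : Fin n) _ => ((hWL2 i).integrable_sq.const_mul _).add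
        (((hV n i).sub (hWL2 i)).integrable_sq.const_mul _)).const_mul _
    · filter_upwards [hB, eventually_gt_atTop 0] with n hn hn0
      have hn' : (0 : ℝ) < n := by exact_mod_cast hn0
      have hs : 0 < √(n : ℝ) := Real.sqrt_pos.2 hn'
      have hint : ∀ i : Fin n, Integrable (fun ω => (V n ω i - W i ω) ^ 2) P := fun i =>
        ((hV n i).sub (hWL2 i)).integrable_sq
      have hint' : ∀ i : Fin n, Integrable
          (fun ω => (√n)⁻¹ * W i ω ^ 2 + (√n + 1) * (V n ω i - W i ω) ^ 2) P := fun i =>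
        ((hWL2 i).integrable_sq.const_mul _).add ((hint i).const_mul _)
      rw [integral_const_mul, integral_finsetSum _ fun i _ => hint' i]
      calc _ ≤ (n : ℝ)⁻¹ * ∑ i : Fin n, ((√n)⁻¹ * τ + (√n + 1) * (B / n)) := by
            gcongr with i
            rw [integral_add ((hWL2 i).integrable_sq.const_mul _) ((hint i).const_mul _),
              integral_const_mul, integral_const_mul, hWi]
            gcongr
            exact hn i
        _ = _ := by
            rw [Finset.sum_const, nsmul_eq_mul, Finset.card_univ, Fintype.card_fin]
            have hq : √(n : ℝ) / n = (√n)⁻¹ := Real.sqrt_div_self'.trans (one_div _)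
            rw [inv_mul_cancel_left₀ hn'.ne', ← hq]
            ring
    · have h3 : Tendsto (fun n : ℕ => (√(n : ℝ))⁻¹) atTop (𝓝 0) :=
        tendsto_inv_atTop_zero.comp (Real.tendsto_sqrt_atTop.comp tendsto_natCast_atTop_atTop)
      have h4 : Tendsto (fun n : ℕ => (n : ℝ)⁻¹) atTop (𝓝 0) :=
        tendsto_inv_atTop_zero.comp tendsto_natCast_atTop_atTop
      simpa using (h3.mul_const τ).add ((h3.add h4).mul_const B)
  rw [tendstoInMeasure_iff_norm] at h1 h2 ⊢
  intro δ hδ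
  have h3 := (h1 (δ / 2) (by positivity)).add (h2 (δ / 2) (by positivity))
  rw [add_zero] at h3
  refine tendsto_of_tendsto_of_tendsto_of_le_of_le tendsto_const_nhds h3
    (fun _ => zero_le) fun n => (measure_mono fun ω hω => ?_).trans (measure_union_le _ _)
  by_contra hc
  simp only [Pi.zero_apply, sub_zero, Set.mem_union, Set.mem_ofPred_eq, not_or, not_le] at hc hω
  have := norm_add_le ((n : ℝ)⁻¹ * ∑ i : Fin n, W i ω ^ 2 - τ)
    ((n : ℝ)⁻¹ * ∑ i, V n ω i ^ 2 - (n : ℝ)⁻¹ * ∑ i : Fin n, W i ω ^ 2)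
  rw [sub_add_sub_cancel'] at this
  linarith [hc.1, hc.2]

/-- Wilks' theorem for a triangular array `V` that approximates a centred i.i.d. sequence `W`: the
errors have mean squares of order `1 / n`, and their sums are bounded in mean square. -/
theorem tendstoInDistribution_neg_two_log_elRatio_of_approx
    {W : ℕ → Ω → ℝ} {V : (n : ℕ) → Ω → Fin n → ℝ} {τ B : ℝ} (hτ : 0 < τ)
    (hind : iIndepFun W P) (hid : ∀ i, IdentDistrib (W i) (W 0) P P) (hL2 : MemLp (W 0) 2 P)
    (h0 : ∫ ω, W 0 ω ∂P = 0) (hvar : ∫ ω, W 0 ω ^ 2 ∂P = τ)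
    (hV : ∀ n i, MemLp (fun ω => V n ω i) 2 P)
    (hB : ∀ᶠ n in atTop, ∀ i : Fin n, ∫ ω, (V n ω i - W i ω) ^ 2 ∂P ≤ B / n)
    (hBs : ∀ᶠ n in atTop, ∫ ω, (∑ i : Fin n, (V n ω i - W i ω)) ^ 2 ∂P ≤ B) :
    TendstoInDistribution (fun n ω => (-2 : EReal) * ENNReal.log (elRatio (V n ω))) atTop
      (fun x : ℝ => ((x ^ 2 : ℝ) : EReal)) (fun _ => P) (gaussianReal 0 1) := by
  have hWL2 : ∀ i, MemLp (W i) 2 P := fun i => (hid i).memLp_iff.2 hL2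
  have hVm : ∀ n, AEMeasurable (V n) P := fun n =>
    aemeasurable_pi_lambda _ fun i => (hV n i).aestronglyMeasurable.aemeasurable
  have hVar : Var[W 0; P] = τ := by
    rw [variance_of_integral_eq_zero hL2.aestronglyMeasurable.aemeasurable h0, hvar]
  have hlaw : HasLaw (fun x : ℝ => √τ * x) (gaussianReal 0 Var[W 0; P].toNNReal)
      (gaussianReal 0 1) := by
    refine ⟨by fun_prop, ?_⟩
    rw [gaussianReal_map_const_mul, hVar]
    congr 1
    · simp
    · ext; simp [Real.sq_sqrt hτ.le, hτ.le]
  have hclt := tendstoInDistribution_inv_sqrt_mul_sum_sub hlaw hL2 hind hid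
  simp only [h0, mul_zero, sub_zero] at hclt
  have hA : TendstoInDistribution (fun (n : ℕ) ω => (√n)⁻¹ * ∑ i, V n ω i) atTop
      (fun x : ℝ => √τ * x) (fun _ => P) (gaussianReal 0 1) := by
    refine tendstoInDistribution_of_tendstoInMeasure_sub _ _ hclt ?_ fun n => ?_
    · refine tendstoInMeasure_zero_of_integral_sq_le (c := fun n => B / n) (fun n => ?_) ?_
        (tendsto_const_div_atTop_nhds_zero_nat B)
      · exact ((memLp_finsetSum _ fun i _ => hV n i).const_mul _).sub
          ((memLp_finsetSum _ fun i _ => hWL2 i).const_mul _)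
      · filter_upwards [hBs] with n hn
        have : ∀ ω, ((fun (n : ℕ) ω => (√n)⁻¹ * ∑ i, V n ω i) - fun (n : ℕ) ω =>
            (√n)⁻¹ * ∑ i ∈ Finset.range n, W i ω) n ω ^ 2
            = (n : ℝ)⁻¹ * (∑ i : Fin n, (V n ω i - W i ω)) ^ 2 := fun ω => by
          simp only [Pi.sub_apply]
          rw [← Fin.sum_univ_eq_sum_range (fun i => W i ω) n, ← mul_sub,
            ← Finset.sum_sub_distrib, mul_pow, inv_pow, Real.sq_sqrt (Nat.cast_nonneg n)]
        simp only [this]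
        rw [integral_const_mul, div_eq_inv_mul]
        gcongr
    · exact ((memLp_finsetSum _ fun i _ => hV n i).const_mul _).aestronglyMeasurable.aemeasurable
  have := tendstoInDistribution_neg_two_log_elRatio hτ hVm hA
    (fun ε hε => exists_eventually_measure_lt_abs_le hA hε)
    (tendstoInMeasure_mean_sq hind hid hL2 hvar hV hB) (fun δ hδ => by
      have h1 := (tendsto_measure_exists_lt_abs hid hL2 (half_pos hδ)).add
        (tendsto_measure_exists_lt_abs_of_integral_sq_le
          (R := fun n ω i => V n ω i - W i ω) (fun n i => (hV n i).sub (hWL2 i)) hB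
          (half_pos hδ))
      rw [add_zero] at h1
      refine tendsto_of_tendsto_of_tendsto_of_le_of_le tendsto_const_nhds h1
        (fun _ => zero_le) fun n => (measure_mono fun ω hω => ?_).trans (measure_union_le _ _)
      obtain ⟨i, hi⟩ := hω
      by_contra hc
      simp only [Set.mem_union, Set.mem_ofPred_eq, not_or, not_exists, not_lt] at hc
      have := abs_add_le (W i ω) (V n ω i - W i ω)
      rw [add_sub_cancel] at this
      linarith [hc.1 i, hc.2 i])
  convert this using 4 with x
  rw [mul_pow, Real.sq_sqrt hτ.le, mul_div_cancel_left₀ _ hτ.ne']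

end Perturbation

/-! ### Moments of degenerate double sums -/

/-- The row sum `∑_{j ≠ i} q i j` of a square array, without the diagonal term. -/
noncomputable def rowSum {ι : Type*} [Fintype ι] [DecidableEq ι] (q : ι → ι → ℝ) (i : ι) : ℝ :=
  ∑ j, if i = j then 0 else q i j

section Degenerate

variable {Ω α : Type*} [MeasurableSpace Ω] [MeasurableSpace α] {P : Measure Ω}
  {μ : Measure α} {Z : ℕ → Ω → α} {H : α → α → ℝ}

lemma integral_sum_sq {ι : Type*} [Fintype ι] {f : ι → Ω → ℝ} (hf : ∀ i, MemLp (f i) 2 P) :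
    ∫ ω, (∑ i, f i ω) ^ 2 ∂P = ∑ i, ∑ j, ∫ ω, f i ω * f j ω ∂P := by
  have hint : ∀ i j, Integrable (fun ω => f i ω * f j ω) P := fun i j =>
    (hf i).integrable_mul (hf j)
  simp only [sq, Finset.sum_mul_sum]
  rw [integral_finsetSum _ fun i _ => integrable_finsetSum _ fun j _ => hint i j]
  exact Finset.sum_congr rfl fun i _ => integral_finsetSum _ fun j _ => hint i j

variable [IsProbabilityMeasure P]

lemma map_prodMk_eq_prod (hind : iIndepFun Z P) (hZ : ∀ i, AEMeasurable (Z i) P)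
    (hμ : ∀ i, P.map (Z i) = μ) {i j : ℕ} (hij : i ≠ j) :
    P.map (fun ω => (Z i ω, Z j ω)) = μ.prod μ := by
  rw [(indepFun_iff_map_prod_eq_prod_map_map (hZ i) (hZ j)).1 (hind.indepFun hij), hμ, hμ]

lemma memLp_kernel (hind : iIndepFun Z P) (hZ : ∀ i, AEMeasurable (Z i) P)
    (hμ : ∀ i, P.map (Z i) = μ) (hHL : MemLp (fun x : α × α => H x.1 x.2) 2 (μ.prod μ)) {i j : ℕ}
    (hij : i ≠ j) : MemLp (fun ω => H (Z i ω) (Z j ω)) 2 P := by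
  rw [← map_prodMk_eq_prod hind hZ hμ hij] at hHL
  exact hHL.comp_of_map ((hZ i).prodMk (hZ j))

lemma integral_kernel_sq (hind : iIndepFun Z P) (hZ : ∀ i, AEMeasurable (Z i) P)
    (hμ : ∀ i, P.map (Z i) = μ) (hHm : Measurable fun x : α × α => H x.1 x.2) {i j : ℕ}
    (hij : i ≠ j) :
    ∫ ω, H (Z i ω) (Z j ω) ^ 2 ∂P = ∫ x, H x.1 x.2 ^ 2 ∂(μ.prod μ) := by
  rw [← map_prodMk_eq_prod hind hZ hμ hij, integral_map ((hZ i).prodMk (hZ j))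
    (hHm.pow_const 2).aestronglyMeasurable]

lemma memLp_offDiag (hind : iIndepFun Z P) (hZ : ∀ i, AEMeasurable (Z i) P)
    (hμ : ∀ i, P.map (Z i) = μ) (hHL : MemLp (fun x : α × α => H x.1 x.2) 2 (μ.prod μ))
    {n : ℕ} (i j : Fin n) :
    MemLp (fun ω => if i = j then 0 else H (Z i ω) (Z j ω)) 2 P := by
  by_cases hij : i = j
  · simp [hij]
  · simp only [if_neg hij]
    exact memLp_kernel hind hZ hμ hHL fun h => hij (Fin.ext h)

lemma memLp_rowSum (hind : iIndepFun Z P) (hZ : ∀ i, AEMeasurable (Z i) P)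
    (hμ : ∀ i, P.map (Z i) = μ) (hHL : MemLp (fun x : α × α => H x.1 x.2) 2 (μ.prod μ))
    {n : ℕ} (i : Fin n) :
    MemLp (fun ω => rowSum (fun a b : Fin n => H (Z a ω) (Z b ω)) i) 2 P :=
  memLp_finsetSum _ fun j _ => memLp_offDiag hind hZ hμ hHL i j

variable [IsProbabilityMeasure μ]

/-- A degenerate kernel evaluated at `(Zᵢ, Zⱼ)` is uncorrelated with every pair not involving
`Zⱼ`: integrate over `Zⱼ` first. -/
lemma integral_kernel_mul_kernel_eq_zero_of_ne (hind : iIndepFun Z P)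
    (hZ : ∀ i, AEMeasurable (Z i) P) (hμ : ∀ i, P.map (Z i) = μ)
    (hHm : Measurable fun x : α × α => H x.1 x.2) (hH0 : ∀ z, ∫ w, H z w ∂μ = 0)
    (hHL : MemLp (fun x : α × α => H x.1 x.2) 2 (μ.prod μ)) {i j k l : ℕ}
    (hij : i ≠ j) (hkl : k ≠ l) (hkj : k ≠ j) (hlj : l ≠ j) :
    ∫ ω, H (Z i ω) (Z j ω) * H (Z k ω) (Z l ω) ∂P = 0 := by
  let S : Finset ℕ := {i, k, l}
  have hiS : i ∈ S := by simp [S]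
  have hkS : k ∈ S := by simp [S]
  have hlS : l ∈ S := by simp [S]
  have hdisj : Disjoint S {j} := by simp [S, hij.symm, hkj.symm, hlj.symm]
  let W : Ω → (S → α) := fun ω m => Z m ω
  have hW : AEMeasurable W P := aemeasurable_pi_lambda _ fun m => hZ m
  have hindW : IndepFun W (Z j) P :=
    (hind.indepFun_finset₀ S {j} hdisj hZ).comp measurable_id
      (measurable_pi_apply (⟨j, by simp⟩ : ({j} : Finset ℕ)))
  let f : (S → α) × α → ℝ := fun x => H (x.1 ⟨i, hiS⟩) x.2 * H (x.1 ⟨k, hkS⟩) (x.1 ⟨l, hlS⟩)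
  have hf : Measurable f :=
    (hHm.comp (f := fun x : (S → α) × α => (x.1 ⟨i, hiS⟩, x.2)) (by fun_prop)).mul
      (hHm.comp (f := fun x : (S → α) × α => (x.1 ⟨k, hkS⟩, x.1 ⟨l, hlS⟩)) (by fun_prop))
  have hlaw := (indepFun_iff_map_prod_eq_prod_map_map hW (hZ j)).1 hindW
  have hint : Integrable f ((P.map W).prod (P.map (Z j))) := by
    rw [← hlaw, integrable_map_measure hf.aestronglyMeasurable (hW.prodMk (hZ j))]
    exact (memLp_kernel hind hZ hμ hHL hij).integrable_mul (memLp_kernel hind hZ hμ hHL hkl)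
  have : IsProbabilityMeasure (P.map W) := Measure.isProbabilityMeasure_map hW
  calc ∫ ω, H (Z i ω) (Z j ω) * H (Z k ω) (Z l ω) ∂P = ∫ ω, f (W ω, Z j ω) ∂P := rfl
    _ = ∫ x, f x ∂((P.map W).prod (P.map (Z j))) := by
        rw [← hlaw, integral_map (hW.prodMk (hZ j)) hf.aestronglyMeasurable]
    _ = 0 := by
        rw [hμ] at hint ⊢
        rw [integral_prod _ hint]
        simp only [f, integral_mul_const, hH0, zero_mul, integral_zero]

/-- For a symmetric degenerate kernel, off-diagonal entries are orthogonal unless they belong to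
the same unordered pair of indices. -/
lemma integral_offDiag_mul_le (hind : iIndepFun Z P)
    (hZ : ∀ i, AEMeasurable (Z i) P) (hμ : ∀ i, P.map (Z i) = μ)
    (hHm : Measurable fun x : α × α => H x.1 x.2) (hHs : ∀ z w, H z w = H w z)
    (hH0 : ∀ z, ∫ w, H z w ∂μ = 0)
    (hHL : MemLp (fun x : α × α => H x.1 x.2) 2 (μ.prod μ)) (i j k l : ℕ) :
    ∫ ω, (if i = j then 0 else H (Z i ω) (Z j ω)) * (if k = l then 0 else H (Z k ω) (Z l ω)) ∂P
      ≤ (∫ x, H x.1 x.2 ^ 2 ∂(μ.prod μ)) *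
        ((if k = i ∧ l = j then 1 else 0) + (if k = j ∧ l = i then 1 else 0)) := by
  set C := ∫ x, H x.1 x.2 ^ 2 ∂(μ.prod μ)
  have hC : 0 ≤ C := integral_nonneg fun _ => sq_nonneg _
  have hnonneg : 0 ≤ C * ((if k = i ∧ l = j then 1 else 0) +
      (if k = j ∧ l = i then 1 else 0)) := by
    refine mul_nonneg hC (add_nonneg ?_ ?_) <;> split_ifs <;> norm_num
  by_cases hij : i = j
  · simpa [hij] using hnonneg
  by_cases hkl : k = l
  · simpa [hkl] using hnonneg
  simp only [if_neg hij, if_neg hkl]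
  have hsq := integral_kernel_sq hind hZ hμ hHm hij
  -- if one of `i`, `j` is not in `{k, l}`, the entries are orthogonal; otherwise the pairs agree
  by_cases hj : k ≠ j ∧ l ≠ j
  · rw [integral_kernel_mul_kernel_eq_zero_of_ne hind hZ hμ hHm hH0 hHL hij hkl hj.1 hj.2]
    exact hnonneg
  by_cases hi : k ≠ i ∧ l ≠ i
  · simp only [hHs (Z i _) (Z j _)]
    rw [integral_kernel_mul_kernel_eq_zero_of_ne hind hZ hμ hHm hH0 hHL (Ne.symm hij) hkl
      hi.1 hi.2]
    exact hnonneg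
  have hcases : (k = i ∧ l = j) ∨ (k = j ∧ l = i) := by omega
  rcases hcases with ⟨rfl, rfl⟩ | ⟨rfl, rfl⟩
  · simp only [← sq, hsq, hkl, Ne.symm hkl, and_self, if_true, if_false, add_zero, mul_one,
      le_refl, C]
  · simp only [hHs (Z k _) (Z l _), ← sq, hsq, hkl, Ne.symm hkl, and_self, if_true, if_false, zero_add,
      mul_one, le_refl, C]

lemma integral_rowSum_sq_le (hind : iIndepFun Z P)
    (hZ : ∀ i, AEMeasurable (Z i) P) (hμ : ∀ i, P.map (Z i) = μ)
    (hHm : Measurable fun x : α × α => H x.1 x.2) (hHs : ∀ z w, H z w = H w z)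
    (hH0 : ∀ z, ∫ w, H z w ∂μ = 0)
    (hHL : MemLp (fun x : α × α => H x.1 x.2) 2 (μ.prod μ)) {n : ℕ} (i : Fin n) :
    ∫ ω, rowSum (fun a b : Fin n => H (Z a ω) (Z b ω)) i ^ 2 ∂P
      ≤ (∫ x, H x.1 x.2 ^ 2 ∂(μ.prod μ)) * (2 * n) := by
  set C := ∫ x, H x.1 x.2 ^ 2 ∂(μ.prod μ)
  have hC : 0 ≤ C := integral_nonneg fun _ => sq_nonneg _
  simp only [rowSum]
  rw [integral_sum_sq fun j => memLp_offDiag hind hZ hμ hHL i j]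
  have hle : ∀ j l : Fin n, ∫ ω, (if i = j then 0 else H (Z i ω) (Z j ω)) *
      (if i = l then 0 else H (Z i ω) (Z l ω)) ∂P
      ≤ C * ((if l = j then 1 else 0) + (if i = j then if l = i then 1 else 0 else 0)) :=
    fun j l => by
    have := integral_offDiag_mul_le hind hZ hμ hHm hHs hH0 hHL i j i l
    simpa only [← Fin.ext_iff, true_and, ite_and] using this
  refine (Finset.sum_le_sum fun j _ => Finset.sum_le_sum fun l _ => hle j l).trans ?_
  simp only [← Finset.mul_sum]
  refine mul_le_mul_of_nonneg_left ?_ hC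
  have : (1 : ℝ) ≤ n := by exact_mod_cast i.pos
  simp [Finset.sum_add_distrib, Finset.sum_ite_irrel]
  linarith

lemma integral_sum_rowSum_sq_le (hind : iIndepFun Z P)
    (hZ : ∀ i, AEMeasurable (Z i) P) (hμ : ∀ i, P.map (Z i) = μ)
    (hHm : Measurable fun x : α × α => H x.1 x.2) (hHs : ∀ z w, H z w = H w z)
    (hH0 : ∀ z, ∫ w, H z w ∂μ = 0)
    (hHL : MemLp (fun x : α × α => H x.1 x.2) 2 (μ.prod μ)) (n : ℕ) :
    ∫ ω, (∑ i, rowSum (fun a b : Fin n => H (Z a ω) (Z b ω)) i) ^ 2 ∂P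
      ≤ (∫ x, H x.1 x.2 ^ 2 ∂(μ.prod μ)) * (2 * n ^ 2) := by
  set C := ∫ x, H x.1 x.2 ^ 2 ∂(μ.prod μ)
  have hC : 0 ≤ C := integral_nonneg fun _ => sq_nonneg _
  have hle : ∀ i j k l : Fin n, ∫ ω, (if i = j then 0 else H (Z i ω) (Z j ω)) *
      (if k = l then 0 else H (Z k ω) (Z l ω)) ∂P
      ≤ C * ((if k = i then if l = j then 1 else 0 else 0)
        + (if k = j then if l = i then 1 else 0 else 0)) := fun i j k l => by
    have := integral_offDiag_mul_le hind hZ hμ hHm hHs hH0 hHL i j k l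
    simpa only [← Fin.ext_iff, ite_and] using this
  simp only [rowSum, ← Fintype.sum_prod_type']
  rw [integral_sum_sq fun x : Fin n × Fin n => memLp_offDiag hind hZ hμ hHL x.1 x.2]
  refine (Finset.sum_le_sum fun x _ => Finset.sum_le_sum fun y _ =>
    hle x.1 x.2 y.1 y.2).trans ?_
  simp only [← Finset.mul_sum]
  refine mul_le_mul_of_nonneg_left (le_of_eq ?_) hC
  simp only [Fintype.sum_prod_type, Finset.sum_add_distrib, Finset.sum_ite_irrel]
  simp
  ring

end Degenerate

/-! ### The jackknife pseudo-values -/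

lemma h_comm (γ : ℝ) (z w : ℝ × ℝ) : h γ z w = h γ w z := by
  simp only [h, h₁, h₂, abs_sub_comm z.1 w.1]
  ring

lemma two_mul_sum_lt {ι : Type*} [LinearOrder ι] (s : Finset ι) {q : ι → ι → ℝ}
    (hq : ∀ i j, q i j = q j i) :
    2 * ∑ i ∈ s, ∑ j ∈ s with i < j, q i j = ∑ i ∈ s, ∑ j ∈ s, if i = j then 0 else q i j := by
  simp only [Finset.sum_filter]
  have hswap : ∑ i ∈ s, ∑ j ∈ s, (if i < j then q i j else 0)
      = ∑ i ∈ s, ∑ j ∈ s, (if j < i then q i j else 0) := by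
    rw [Finset.sum_comm]
    simp only [hq]
  rw [two_mul]
  nth_rw 2 [hswap]
  simp only [← Finset.sum_add_distrib]
  refine Finset.sum_congr rfl fun i _ => Finset.sum_congr rfl fun j _ => ?_
  rcases lt_trichotomy i j with hij | rfl | hij
  · simp [hij, hij.ne, hij.le]
  · simp
  · simp [hij, hij.ne', hij.le]

lemma sum_rowSum_erase {ι : Type*} [Fintype ι] [DecidableEq ι] {q : ι → ι → ℝ}
    (hq : ∀ i j, q i j = q j i) (i : ι) :
    ∑ a ∈ Finset.univ.erase i, ∑ b ∈ Finset.univ.erase i, (if a = b then 0 else q a b)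
      = ∑ a, rowSum q a - 2 * rowSum q i := by
  have hcol : ∑ a, (if a = i then 0 else q a i) = rowSum q i := by
    simp only [rowSum, hq i, eq_comm (a := i)]
  simp only [Finset.sum_erase_eq_sub (Finset.mem_univ i), Finset.sum_sub_distrib, hcol]
  simp [rowSum]
  ring

/-- The Hoeffding decomposition of the pseudo-values: each one is twice the projection of its
observation, up to the row and double sums of the degenerate part of the kernel. -/
lemma pseudoValue_eq {n : ℕ} (hn : 3 ≤ n) (γ : ℝ) (z : Fin n → ℝ × ℝ) (g : ℝ × ℝ → ℝ)
    (i : Fin n) :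
    pseudoValue γ z i = 2 * g (z i) +
      (2 / ((n : ℝ) - 2) * rowSum (fun a b => h γ (z a) (z b) - g (z a) - g (z b)) i
        - 1 / (((n : ℝ) - 1) * (n - 2)) *
          ∑ a, rowSum (fun a b => h γ (z a) (z b) - g (z a) - g (z b)) a) := by
  have hn' : (3 : ℝ) ≤ n := by exact_mod_cast hn
  have hn0 : (n : ℝ) ≠ 0 := by linarith
  have hn1 : (n : ℝ) - 1 ≠ 0 := by linarith
  have hn2 : (n : ℝ) - 2 ≠ 0 := by linarith
  set q : Fin n → Fin n → ℝ := fun a b => h γ (z a) (z b) with hqdef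
  have hq : ∀ a b, q a b = q b a := fun a b => h_comm _ _ _
  set G := ∑ a, g (z a) with hG
  have hrow : ∀ a, rowSum (fun a b => h γ (z a) (z b) - g (z a) - g (z b)) a
      = rowSum q a - (n - 2) * g (z a) - G := fun a => by
    have : ∀ b, (if a = b then 0 else h γ (z a) (z b) - g (z a) - g (z b))
        = (if a = b then 0 else q a b) - (g (z a) - if a = b then g (z a) else 0)
          - (g (z b) - if a = b then g (z b) else 0) := fun b => by
      split_ifs <;> simp [hqdef]
    simp only [rowSum, this, Finset.sum_sub_distrib, ← hG]
    simp
    ring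
  have hU : uFunctional γ z Finset.univ = (∑ a, rowSum q a) / (n * (n - 1)) := by
    have h2 : 2 * ∑ a, ∑ b with a < b, h γ (z a) (z b) = ∑ a, rowSum q a :=
      two_mul_sum_lt Finset.univ hq
    simp only [uFunctional, Finset.card_univ, Fintype.card_fin, Nat.cast_choose_two]
    rw [← h2]
    field_simp
  have hUi : uFunctional γ z (Finset.univ.erase i)
      = (∑ a, rowSum q a - 2 * rowSum q i) / ((n - 1) * (n - 2)) := by
    have h2 : 2 * ∑ a ∈ Finset.univ.erase i, ∑ b ∈ Finset.univ.erase i with a < b,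
        h γ (z a) (z b) = ∑ a, rowSum q a - 2 * rowSum q i :=
      (two_mul_sum_lt (Finset.univ.erase i) hq).trans (sum_rowSum_erase hq i)
    simp only [uFunctional, Finset.card_erase_of_mem (Finset.mem_univ i), Finset.card_univ,
      Fintype.card_fin, Nat.cast_choose_two]
    rw [← h2, Nat.cast_sub (by omega), Nat.cast_one, show (n : ℝ) - 1 - 1 = n - 2 by ring]
    field_simp
  rw [pseudoValue, hU, hUi]
  simp only [hrow, Finset.sum_sub_distrib, ← Finset.mul_sum, ← hG]
  simp
  field_simp
  ring

section Wilks

variable {Ω : Type*} [MeasurableSpace Ω] {P : Measure Ω} [IsProbabilityMeasure P]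
  {μ : Measure (ℝ × ℝ)} {Z : ℕ → Ω → ℝ × ℝ} {γ : ℝ} {g : ℝ × ℝ → ℝ}

lemma memLp_pseudoValue (hind : iIndepFun Z P) (hZ : ∀ i, AEMeasurable (Z i) P)
    (hμ : ∀ i, P.map (Z i) = μ) (hL : MemLp (fun x : (ℝ × ℝ) × (ℝ × ℝ) => h γ x.1 x.2) 2 (μ.prod μ))
    {n : ℕ} (i : Fin n) :
    MemLp (fun ω => pseudoValue γ (fun j : Fin n => Z j ω) i) 2 P := by
  have hU : ∀ s : Finset (Fin n), MemLp (fun ω => uFunctional γ (fun j : Fin n => Z j ω) s) 2 P :=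
    fun s => (memLp_finsetSum _ fun a _ => memLp_finsetSum _ fun b hb =>
      memLp_kernel hind hZ hμ hL fun hab =>
        (Finset.mem_filter.1 hb).2.ne (Fin.ext hab)).const_mul _
  exact ((hU _).const_mul _).sub ((hU _).const_mul _)

variable [IsProbabilityMeasure μ]

/-- Wilks' theorem for the jackknife empirical likelihood with kernel `h`, in terms of the
projection `g` of `h`. -/
theorem tendstoInDistribution_neg_two_log_jelRatio (hind : iIndepFun Z P)
    (hid : ∀ i, IdentDistrib (Z i) (Z 0) P P) (hμ : P.map (Z 0) = μ)
    (hhm : Measurable fun x : (ℝ × ℝ) × (ℝ × ℝ) => h γ x.1 x.2)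
    (hhL : MemLp (fun x : (ℝ × ℝ) × (ℝ × ℝ) => h γ x.1 x.2) 2 (μ.prod μ))
    (hhi : ∀ z, Integrable (h γ z) μ) (hgm : Measurable g) (hg : ∀ z, g z = ∫ w, h γ z w ∂μ)
    (hgL : MemLp g 2 μ) (hg0 : ∫ z, g z ∂μ = 0) (hgpos : 0 < ∫ z, g z ^ 2 ∂μ) :
    TendstoInDistribution
      (fun (n : ℕ) ω => (-2 : EReal) * ENNReal.log (jelRatio γ (fun i : Fin n => Z i ω))) atTop
      (fun x : ℝ => ((x ^ 2 : ℝ) : EReal)) (fun _ => P) (gaussianReal 0 1) := by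
  have hZ : ∀ i, AEMeasurable (Z i) P := fun i => (hid i).aemeasurable_fst
  have hμ' : ∀ i, P.map (Z i) = μ := fun i => (hid i).map_eq.trans hμ
  have hgi : Integrable g μ := hgL.integrable one_le_two
  -- the degenerate part of the kernel
  set H : ℝ × ℝ → ℝ × ℝ → ℝ := fun z w => h γ z w - g z - g w with hH
  have hHm : Measurable fun x : (ℝ × ℝ) × (ℝ × ℝ) => H x.1 x.2 :=
    (hhm.sub (hgm.comp measurable_fst)).sub (hgm.comp measurable_snd)
  have hHs : ∀ z w, H z w = H w z := fun z w => by simp only [hH, h_comm γ z w]; ring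
  have hH0 : ∀ z, ∫ w, H z w ∂μ = 0 := fun z => by
    have h1 : Integrable (fun w => h γ z w - g z) μ := (hhi z).sub (integrable_const _)
    simp only [hH]
    rw [integral_sub h1 hgi, integral_sub (hhi z) (integrable_const _), hg0, ← hg]
    simp
  have hHL : MemLp (fun x : (ℝ × ℝ) × (ℝ × ℝ) => H x.1 x.2) 2 (μ.prod μ) :=
    (hhL.sub (hgL.comp_measurePreserving measurePreserving_fst)).sub
      (hgL.comp_measurePreserving measurePreserving_snd)
  set C := ∫ x, H x.1 x.2 ^ 2 ∂(μ.prod μ) with hCdef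
  have hC : 0 ≤ C := integral_nonneg fun _ => sq_nonneg _
  set D : (n : ℕ) → Ω → Fin n → ℝ := fun n ω i => rowSum (fun a b : Fin n => H (Z a ω) (Z b ω)) i
    with hD
  have hDL : ∀ n i, MemLp (fun ω => D n ω i) 2 P := fun n i => memLp_rowSum hind hZ hμ' hHL i
  have hDsL : ∀ n, MemLp (fun ω => ∑ i, D n ω i) 2 P := fun n =>
    memLp_finsetSum _ fun i _ => hDL n i
  have hDi : ∀ (n : ℕ) (i : Fin n), ∫ ω, D n ω i ^ 2 ∂P ≤ C * (2 * n) := fun n i =>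
    integral_rowSum_sq_le hind hZ hμ' hHm hHs hH0 hHL i
  have hDs : ∀ n : ℕ, ∫ ω, (∑ i, D n ω i) ^ 2 ∂P ≤ C * (2 * n ^ 2) := fun n =>
    integral_sum_rowSum_sq_le hind hZ hμ' hHm hHs hH0 hHL n
  have hdiff : ∀ n ≥ 4, ∀ ω (i : Fin n),
      pseudoValue γ (fun j : Fin n => Z j ω) i - 2 * g (Z i ω)
        = 2 / ((n : ℝ) - 2) * D n ω i - 1 / (((n : ℝ) - 1) * (n - 2)) * ∑ a, D n ω a :=
    fun n hn ω i => by rw [pseudoValue_eq (by omega) γ _ g i]; simp only [hD, hH]; ring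
  have hgZ : MemLp (fun ω => g (Z 0 ω)) 2 P := by
    rw [← hμ] at hgL; exact hgL.comp_of_map (hZ 0)
  refine tendstoInDistribution_neg_two_log_elRatio_of_approx (W := fun i ω => 2 * g (Z i ω))
    (V := fun n ω => pseudoValue γ fun j : Fin n => Z j ω) (τ := 4 * ∫ z, g z ^ 2 ∂μ)
    (B := 128 * C) (by positivity)
    (hind.comp (fun _ z => 2 * g z) fun _ => hgm.const_mul 2)
    (fun i => (hid i).comp (hgm.const_mul 2)) (hgZ.const_mul 2) ?_ ?_
    (fun n i => memLp_pseudoValue hind hZ hμ' hhL i) ?_ ?_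
  · rw [integral_const_mul, ← integral_map (hZ 0) hgm.aestronglyMeasurable, hμ, hg0, mul_zero]
  · simp only [mul_pow]
    rw [integral_const_mul, ← integral_map (hZ 0) (f := fun z => g z ^ 2)
      (hgm.pow_const 2).aestronglyMeasurable, hμ]
    norm_num
  · filter_upwards [eventually_ge_atTop 4] with n hn i
    have hn' : (4 : ℝ) ≤ n := by exact_mod_cast hn
    -- `n ≥ 4` gives `n - 2 ≥ n / 2`, which turns all denominators into powers of `n`
    have hn2 : (n : ℝ) / 2 ≤ n - 2 := by linarith
    have hn1 : (n : ℝ) / 2 ≤ n - 1 := by linarith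
    have hn0 : (0 : ℝ) < n := by linarith
    simp only [hdiff n hn]
    calc ∫ ω, (2 / ((n : ℝ) - 2) * D n ω i
          - 1 / (((n : ℝ) - 1) * (n - 2)) * ∑ a, D n ω a) ^ 2 ∂P
        ≤ ∫ ω, (32 / (n : ℝ) ^ 2 * D n ω i ^ 2 + 32 / (n : ℝ) ^ 4 * (∑ a, D n ω a) ^ 2) ∂P := by
          refine integral_mono ?_ ?_ fun ω => ?_
          · exact (((hDL n i).const_mul _).sub ((hDsL n).const_mul _)).integrable_sq
          · exact ((hDL n i).integrable_sq.const_mul _).add ((hDsL n).integrable_sq.const_mul _)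
          · have e1 : 2 / ((n : ℝ) - 2) ≤ 4 / n := by
              rw [div_le_div_iff₀ (by linarith) hn0]; linarith
            have e2 : 1 / (((n : ℝ) - 1) * (n - 2)) ≤ 4 / n ^ 2 := by
              rw [div_le_div_iff₀ (by nlinarith) (by positivity)]; nlinarith
            have p1 : 0 ≤ 2 / ((n : ℝ) - 2) := div_nonneg (by norm_num) (by linarith)
            have p2 : 0 ≤ 1 / (((n : ℝ) - 1) * (n - 2)) := div_nonneg (by norm_num) (by nlinarith)
            have e1' : (2 / ((n : ℝ) - 2)) ^ 2 ≤ (4 / n) ^ 2 := by gcongr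
            have e2' : (1 / (((n : ℝ) - 1) * (n - 2))) ^ 2 ≤ (4 / n ^ 2) ^ 2 := by gcongr
            calc _ ≤ 2 * ((2 / ((n : ℝ) - 2)) ^ 2 * D n ω i ^ 2
                  + (1 / (((n : ℝ) - 1) * (n - 2))) ^ 2 * (∑ a, D n ω a) ^ 2) := by
                  nlinarith [sq_nonneg (2 / ((n : ℝ) - 2) * D n ω i
                    + 1 / (((n : ℝ) - 1) * (n - 2)) * ∑ a, D n ω a)]
              _ ≤ 2 * ((4 / n) ^ 2 * D n ω i ^ 2 + (4 / n ^ 2) ^ 2 * (∑ a, D n ω a) ^ 2) := by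
                  gcongr
              _ = _ := by ring
      _ = 32 / (n : ℝ) ^ 2 * ∫ ω, D n ω i ^ 2 ∂P
          + 32 / (n : ℝ) ^ 4 * ∫ ω, (∑ a, D n ω a) ^ 2 ∂P := by
          rw [integral_add ((hDL n i).integrable_sq.const_mul _)
            ((hDsL n).integrable_sq.const_mul _), integral_const_mul, integral_const_mul]
      _ ≤ 32 / (n : ℝ) ^ 2 * (C * (2 * n)) + 32 / (n : ℝ) ^ 4 * (C * (2 * n ^ 2)) := by
          gcongr
          exacts [hDi n i, hDs n]
      _ = 64 * C / n + 64 * C / n * (1 / n) := by field_simp; ring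
      _ ≤ 64 * C / n + 64 * C / n * 1 := by
          gcongr
          rw [div_le_one hn0]; linarith
      _ = 128 * C / n := by ring
  · filter_upwards [eventually_ge_atTop 4] with n hn
    have hn' : (4 : ℝ) ≤ n := by exact_mod_cast hn
    have hn1 : (n : ℝ) / 2 ≤ n - 1 := by linarith
    have hn0 : (0 : ℝ) < n := by linarith
    have hsum : ∀ ω, (∑ i : Fin n, (pseudoValue γ (fun j : Fin n => Z j ω) i - 2 * g (Z i ω))) ^ 2
        = ((n : ℝ) - 1)⁻¹ ^ 2 * (∑ a, D n ω a) ^ 2 := fun ω => by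
      simp only [hdiff n hn, Finset.sum_sub_distrib, ← Finset.mul_sum]
      have h1 : (n : ℝ) - 1 ≠ 0 := by linarith
      have h2 : (n : ℝ) - 2 ≠ 0 := by linarith
      rw [← mul_pow]
      congr 1
      simp
      field_simp
      ring
    simp only [hsum]
    rw [integral_const_mul]
    calc ((n : ℝ) - 1)⁻¹ ^ 2 * ∫ ω, (∑ a, D n ω a) ^ 2 ∂P
        ≤ ((n : ℝ) / 2)⁻¹ ^ 2 * (C * (2 * n ^ 2)) := by
          have : 0 ≤ ((n : ℝ) - 1)⁻¹ := inv_nonneg.2 (by linarith)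
          gcongr
          exact hDs n
      _ = 8 * C := by field_simp; ring
      _ ≤ 128 * C := by linarith

end Wilks

/-! ### The Gini covariance as the mean of a kernel -/

lemma nullSingletonClass_of_continuous_cdf (m : Measure ℝ) [IsProbabilityMeasure m]
    (hc : Continuous (cdf m)) : NullSingletonClass m := by
  refine ⟨fun a => ?_⟩
  rw [← measure_cdf m, StieltjesFunction.measure_singleton,
    hc.continuousAt.continuousWithinAt.leftLim_eq, sub_self, ENNReal.ofReal_zero]

section GiniCovariance

variable {α : Type*} [MeasurableSpace α] {ν : Measure α} [IsProbabilityMeasure ν] {f y : α → ℝ}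

lemma integral_ite_lt_const (hy : Measurable y) (hc : Continuous (cdf (ν.map y))) (t : ℝ) :
    ∫ w, (if t > y w then 1 else 0 : ℝ) ∂ν = cdf (ν.map y) t := by
  have := Measure.isProbabilityMeasure_map (μ := ν) hy.aemeasurable
  have := nullSingletonClass_of_continuous_cdf _ hc
  rw [cdf_eq_real, ← measureReal_congr (Iio_ae_eq_Iic (μ := ν.map y)),
    map_measureReal_apply hy measurableSet_Iio,
    ← integral_indicator_one (hy measurableSet_Iio)]
  rfl

lemma integral_ite_const_lt (hy : Measurable y) (t : ℝ) :
    ∫ w, (if y w > t then 1 else 0 : ℝ) ∂ν = 1 - cdf (ν.map y) t := by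
  have := Measure.isProbabilityMeasure_map (μ := ν) hy.aemeasurable
  rw [cdf_eq_real, ← probReal_compl_eq_one_sub measurableSet_Iic, Set.compl_Iic,
    map_measureReal_apply hy measurableSet_Ioi,
    ← integral_indicator_one (hy measurableSet_Ioi)]
  rfl

lemma integral_sign_kernel (hf : Integrable f ν) (hy : Measurable y)
    (hc : Continuous (cdf (ν.map y))) :
    ∫ x : α × α, ((f x.1 - f x.2) * (if y x.1 > y x.2 then 1 else 0)
        + (f x.2 - f x.1) * (if y x.2 > y x.1 then 1 else 0)) ∂(ν.prod ν)
      = 4 * ∫ z, f z * cdf (ν.map y) (y z) ∂ν - 2 * ∫ z, f z ∂ν := by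
  let I : α × α → ℝ := fun x => if y x.1 > y x.2 then 1 else 0
  have hI : Measurable I := Measurable.ite
    (measurableSet_lt (hy.comp measurable_snd) (hy.comp measurable_fst)) measurable_const
    measurable_const
  have hIb : ∀ x, ‖I x‖ ≤ 1 := fun x => by simp only [I]; split_ifs <;> simp
  have hi1 : Integrable (fun x : α × α => f x.1 * I x) (ν.prod ν) :=
    (hf.comp_fst ν).mul_bdd hI.aestronglyMeasurable (ae_of_all _ hIb)
  have hi2 : Integrable (fun x : α × α => f x.2 * I x) (ν.prod ν) :=
    (hf.comp_snd ν).mul_bdd hI.aestronglyMeasurable (ae_of_all _ hIb)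
  have hGm : Measurable fun z => cdf (ν.map y) (y z) := (monotone_cdf _).measurable.comp hy
  have hfG : Integrable (fun z => f z * cdf (ν.map y) (y z)) ν :=
    hf.mul_bdd (c := 1) hGm.aestronglyMeasurable (ae_of_all _ fun z => by
      rw [Real.norm_of_nonneg (cdf_nonneg _ _)]; exact cdf_le_one _ _)
  have h1 : ∫ x : α × α, f x.1 * I x ∂(ν.prod ν) = ∫ z, f z * cdf (ν.map y) (y z) ∂ν := by
    rw [integral_prod _ hi1]
    simp only [I, integral_const_mul, integral_ite_lt_const hy hc]
  have h2 : ∫ x : α × α, f x.2 * I x ∂(ν.prod ν)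
      = ∫ z, f z ∂ν - ∫ z, f z * cdf (ν.map y) (y z) ∂ν := by
    rw [integral_prod_symm _ hi2, ← integral_sub hf hfG]
    simp only [I, integral_const_mul, integral_ite_const_lt hy, mul_sub, mul_one]
  -- the two halves of the kernel are exchanged by swapping the variables
  let u : α × α → ℝ := fun x => f x.1 * I x - f x.2 * I x
  have hu : Integrable u (ν.prod ν) := hi1.sub hi2
  have hu' : Integrable (fun x => u x.swap) (ν.prod ν) := hu.swap
  have h3 : ∫ x, u x ∂(ν.prod ν)
      = 2 * ∫ z, f z * cdf (ν.map y) (y z) ∂ν - ∫ z, f z ∂ν := by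
    simp only [u]
    rw [integral_sub hi1 hi2, h1, h2]
    ring
  calc _ = ∫ x, (u x + u x.swap) ∂(ν.prod ν) := by
        congr 1
        ext x
        simp only [u, I, Prod.fst_swap, Prod.snd_swap]
        ring
    _ = _ := by
        rw [integral_add hu hu', integral_prod_swap u, h3]
        ring

/-- The covariance of `f` with the probability integral transform of `y`, as the mean of a
symmetric kernel over two independent observations. -/
lemma integral_sign_kernel_eq_cov (hf : MemLp f 2 ν) (hy : Measurable y)
    (hc : Continuous (cdf (ν.map y))) :
    ∫ x : α × α, 1 / 4 * ((f x.1 - f x.2) * (if y x.1 > y x.2 then 1 else 0)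
        + (f x.2 - f x.1) * (if y x.2 > y x.1 then 1 else 0)) ∂(ν.prod ν)
      = cov[f, fun z => cdf (ν.map y) (y z); ν] := by
  have hGm : Measurable fun z => cdf (ν.map y) (y z) := (monotone_cdf _).measurable.comp hy
  have hG : MemLp (fun z => cdf (ν.map y) (y z)) 2 ν :=
    MemLp.of_bound hGm.aestronglyMeasurable 1 (ae_of_all _ fun z => by
      rw [Real.norm_of_nonneg (cdf_nonneg _ _)]; exact cdf_le_one _ _)
  -- the kernel identity for `f = 1` says that the transform of `y` has mean `1 / 2`
  have hone := integral_sign_kernel (ν := ν) (f := fun _ => 1)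
    (integrable_const _) hy hc
  simp only [sub_self, zero_mul, add_zero, integral_zero, one_mul, integral_const, probReal_univ,
    smul_eq_mul, mul_one] at hone
  rw [covariance_eq_sub hf hG, integral_const_mul,
    integral_sign_kernel (hf.integrable one_le_two) hy hc]
  simp only [Pi.mul_apply]
  have : ∫ z, cdf (ν.map y) (y z) ∂ν = 1 / 2 := by linarith
  rw [this]
  ring

lemma sub_mul_ite_add_sub_mul_ite (a b : ℝ) :
    (a - b) * (if a > b then 1 else 0) + (b - a) * (if b > a then 1 else 0) = |a - b| := by
  rcases lt_trichotomy a b with h | rfl | h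
  · simp [h, h.not_gt, abs_of_neg (sub_neg.2 h)]
  · simp
  · simp [h, h.not_gt, abs_of_pos (sub_pos.2 h)]

lemma cov_cdf_ne_zero (hfm : Measurable f) (hf : MemLp f 2 ν)
    (hc : Continuous (cdf (ν.map f))) : cov[f, fun z => cdf (ν.map f) (f z); ν] ≠ 0 := by
  have := Measure.isProbabilityMeasure_map (μ := ν) hfm.aemeasurable
  have := nullSingletonClass_of_continuous_cdf _ hc
  rw [← integral_sign_kernel_eq_cov hf hfm hc]
  simp only [sub_mul_ite_add_sub_mul_ite]
  have hint : Integrable (fun x : α × α => 1 / 4 * |f x.1 - f x.2|) (ν.prod ν) :=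
    (((hf.integrable one_le_two).comp_fst ν).sub
      ((hf.integrable one_le_two).comp_snd ν)).abs.const_mul _
  intro h0
  rw [integral_eq_zero_iff_of_nonneg (fun x => by positivity) hint] at h0
  have hne : ∀ᵐ x ∂(ν.prod ν), f x.1 ≠ f x.2 := by
    have hS : MeasurableSet {x : α × α | f x.1 ≠ f x.2} :=
      (measurableSet_eq_fun (hfm.comp measurable_fst) (hfm.comp measurable_snd)).compl
    rw [Measure.ae_prod_iff_ae_ae hS]
    refine ae_of_all _ fun z => ?_
    rw [ae_iff]
    have : {w | ¬ f z ≠ f w} = f ⁻¹' {f z} := by ext w; simp [eq_comm]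
    rw [this, ← Measure.map_apply hfm (measurableSet_singleton _), measure_singleton]
  obtain ⟨x, hx1, hx2⟩ := (h0.and hne).exists
  simp only [Pi.zero_apply, mul_eq_zero, abs_eq_zero, sub_eq_zero] at hx1
  norm_num at hx1
  exact hx2 hx1

end GiniCovariance

/-! ### The Gini kernel -/

section GiniKernel

lemma measurable_h (γ : ℝ) : Measurable fun x : (ℝ × ℝ) × (ℝ × ℝ) => h γ x.1 x.2 := by
  unfold h h₁ h₂
  have m1 : Measurable fun x : (ℝ × ℝ) × (ℝ × ℝ) => (if x.1.2 > x.2.2 then 1 else 0 : ℝ) :=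
    Measurable.ite (measurableSet_lt (by fun_prop) (by fun_prop)) measurable_const measurable_const
  have m2 : Measurable fun x : (ℝ × ℝ) × (ℝ × ℝ) => (if x.2.2 > x.1.2 then 1 else 0 : ℝ) :=
    Measurable.ite (measurableSet_lt (by fun_prop) (by fun_prop)) measurable_const measurable_const
  fun_prop

lemma abs_h_le (γ : ℝ) (z w : ℝ × ℝ) : |h γ z w| ≤ (|γ| + 1) * (|z.1| + |w.1|) := by
  have h1 : |h₁ z w| ≤ |z.1 - w.1| := by
    simp only [h₁]
    have := abs_nonneg (z.1 - w.1)
    rcases lt_trichotomy z.2 w.2 with hl | hl | hl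
    · simp [hl, hl.not_gt, abs_mul, abs_sub_comm w.1 z.1]
      linarith
    · simp [hl]
    · simp [hl, hl.not_gt, abs_mul]
      linarith
  have h2 : |h₂ z w| ≤ |z.1 - w.1| := by
    simp only [h₂, abs_mul, abs_abs]
    rw [abs_of_pos (by norm_num : (0 : ℝ) < 1 / 4)]
    linarith [abs_nonneg (z.1 - w.1)]
  calc |h γ z w| ≤ |h₂ z w| * |γ| + |h₁ z w| := by
        rw [← abs_mul]; exact abs_sub _ _
    _ ≤ |z.1 - w.1| * |γ| + |z.1 - w.1| := by gcongr
    _ = (|γ| + 1) * |z.1 - w.1| := by ring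
    _ ≤ _ := by gcongr; exact abs_sub _ _

variable {μ : Measure (ℝ × ℝ)} [IsProbabilityMeasure μ]

lemma integrable_h (γ : ℝ) (hX : Integrable Prod.fst μ) (z : ℝ × ℝ) : Integrable (h γ z) μ :=
  (((integrable_const |z.1|).add hX.abs).const_mul (|γ| + 1)).mono'
    ((measurable_h γ).comp measurable_prodMk_left).aestronglyMeasurable
    (ae_of_all _ fun w => abs_h_le γ z w)

lemma memLp_h (γ : ℝ) (hX : MemLp Prod.fst 2 μ) :
    MemLp (fun x : (ℝ × ℝ) × (ℝ × ℝ) => h γ x.1 x.2) 2 (μ.prod μ) := by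
  have h1 : MemLp (fun x : (ℝ × ℝ) × (ℝ × ℝ) => |x.1.1|) 2 (μ.prod μ) :=
    (hX.comp_measurePreserving (f := Prod.fst) (measurePreserving_fst (μ := μ) (ν := μ))).abs
  have h2 : MemLp (fun x : (ℝ × ℝ) × (ℝ × ℝ) => |x.2.1|) 2 (μ.prod μ) :=
    (hX.comp_measurePreserving (f := Prod.snd) (measurePreserving_snd (μ := μ) (ν := μ))).abs
  refine ((h1.add h2).const_mul (|γ| + 1)).mono' (measurable_h γ).aestronglyMeasurable
    (ae_of_all _ fun x => abs_h_le γ x.1 x.2)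

lemma measurable_integral_h (γ : ℝ) : Measurable fun z => ∫ w, h γ z w ∂μ :=
  (StronglyMeasurable.integral_prod_right (f := h γ) (measurable_h γ).stronglyMeasurable).measurable

lemma memLp_integral_h (γ : ℝ) (hX : MemLp Prod.fst 2 μ) :
    MemLp (fun z => ∫ w, h γ z w ∂μ) 2 μ := by
  have hXi : Integrable Prod.fst μ := hX.integrable one_le_two
  refine ((hX.abs.add (memLp_const (∫ w, |w.1| ∂μ))).const_mul (|γ| + 1)).mono'
    (measurable_integral_h γ).aestronglyMeasurable (ae_of_all _ fun z => ?_)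
  calc ‖∫ w, h γ z w ∂μ‖ ≤ ∫ w, |h γ z w| ∂μ := norm_integral_le_integral_norm _
    _ ≤ ∫ w, (|γ| + 1) * (|z.1| + |w.1|) ∂μ :=
        integral_mono (integrable_h γ hXi z).abs
          (((integrable_const _).add hXi.abs).const_mul _) fun w => abs_h_le γ z w
    _ = (|γ| + 1) * (|z.1| + ∫ w, |w.1| ∂μ) := by
        rw [integral_const_mul, integral_add (integrable_const _) hXi.abs]
        simp

/-- At the Gini correlation the kernel `h` has mean zero. -/
lemma integral_h_eq_zero {γ : ℝ} (hX : MemLp Prod.fst 2 μ)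
    (hF : Continuous (cdf (μ.map Prod.fst))) (hG : Continuous (cdf (μ.map Prod.snd)))
    (hγ : γ = giniCorrelation μ Prod.fst Prod.snd) :
    ∫ x : (ℝ × ℝ) × (ℝ × ℝ), h γ x.1 x.2 ∂(μ.prod μ) = 0 := by
  have e1 := integral_sign_kernel_eq_cov (ν := μ) hX measurable_snd hG
  have e2 := integral_sign_kernel_eq_cov (ν := μ) hX measurable_fst hF
  simp only [sub_mul_ite_add_sub_mul_ite] at e2
  have hne := cov_cdf_ne_zero (ν := μ) measurable_fst hX hF
  have hi0 := (memLp_h (μ := μ) 0 hX).integrable one_le_two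
  have hi1 := (memLp_h (μ := μ) 1 hX).integrable one_le_two
  have hi : Integrable (fun x : (ℝ × ℝ) × (ℝ × ℝ) => h₂ x.1 x.2) (μ.prod μ) :=
    (hi1.sub hi0).congr (ae_of_all _ fun x => by simp [h])
  have hi' : Integrable (fun x : (ℝ × ℝ) × (ℝ × ℝ) => h₁ x.1 x.2) (μ.prod μ) :=
    hi0.neg.congr (ae_of_all _ fun x => by simp [h])
  simp only [h]
  rw [integral_sub (hi.mul_const γ) hi', integral_mul_const]
  simp only [h₁, h₂]
  rw [e1, e2, hγ, giniCorrelation, mul_div_cancel₀ _ hne, sub_self]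

end GiniKernel

end GiniJEL

/-! ### The jackknife empirical likelihood of the Gini correlation -/

/-- Wilks' theorem for the jackknife empirical likelihood of the Gini correlation. The statistic
takes values in the extended reals: it is `+∞` where the likelihood ratio is `0`. -/
theorem theorem1 {Ω : Type*} [MeasurableSpace Ω] (P : Measure Ω) [IsProbabilityMeasure P]
    (X Y : ℕ → Ω → ℝ)
    (hindep : iIndepFun (fun i ω => (X i ω, Y i ω)) P)
    (hident : ∀ i, IdentDistrib (fun ω => (X i ω, Y i ω)) (fun ω => (X 0 ω, Y 0 ω)) P P)
    (hF : Continuous (cdf (P.map (X 0))))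
    (hG : Continuous (cdf (P.map (Y 0))))
    (hX : MemLp (X 0) 2 P)
    (hY : MemLp (Y 0) 2 P)
    (γ : ℝ) (hγ : γ = GiniJEL.giniCorrelation P (X 0) (Y 0))
    (hσ : 0 < GiniJEL.sigmaSq P (fun ω => (X 0 ω, Y 0 ω)) γ) :
    TendstoInDistribution
      (fun (n : ℕ) ω =>
        (-2 : EReal) * ENNReal.log (GiniJEL.jelRatio γ (fun i : Fin n => (X i ω, Y i ω))))
      atTop (fun x : ℝ => (x : EReal)) (fun _ => P) GiniJEL.chiSqOne := by
  set Z : ℕ → Ω → ℝ × ℝ := fun i ω => (X i ω, Y i ω) with hZdef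
  have hZ : AEMeasurable (Z 0) P := (hident 0).aemeasurable_fst
  have hμ := Measure.isProbabilityMeasure_map hZ
  set μ := P.map (Z 0) with hμdef
  have hfst : μ.map Prod.fst = P.map (X 0) :=
    AEMeasurable.map_map_of_aemeasurable measurable_fst.aemeasurable hZ
  have hsnd : μ.map Prod.snd = P.map (Y 0) :=
    AEMeasurable.map_map_of_aemeasurable measurable_snd.aemeasurable hZ
  have hXμ : MemLp Prod.fst 2 μ :=
    (memLp_map_measure_iff measurable_fst.aestronglyMeasurable hZ).2 hX
  have hγμ : γ = GiniJEL.giniCorrelation μ Prod.fst Prod.snd := by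
    have hc : ∀ (p : ℝ × ℝ → ℝ) (m : Measure ℝ), Measurable p →
        cov[Prod.fst, fun z => cdf m (p z); μ] = cov[X 0, fun ω => cdf m (p (Z 0 ω)); P] :=
      fun p m hp => covariance_map measurable_fst.aestronglyMeasurable
        ((monotone_cdf m).measurable.comp hp).aestronglyMeasurable hZ
    rw [hγ, GiniJEL.giniCorrelation, GiniJEL.giniCorrelation, hfst, hsnd,
      hc _ _ measurable_fst, hc _ _ measurable_snd]
  set g : ℝ × ℝ → ℝ := fun z => ∫ w, GiniJEL.h γ z w ∂μ with hg
  have hgm : Measurable g := GiniJEL.measurable_integral_h γ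
  have hhL := GiniJEL.memLp_h γ hXμ
  have hg0 : ∫ z, g z ∂μ = 0 := by
    rw [← GiniJEL.integral_h_eq_zero hXμ (hfst ▸ hF) (hsnd ▸ hG) hγμ,
      integral_prod _ (hhL.integrable one_le_two)]
  have hproj : ∀ z, GiniJEL.proj P (Z 0) γ z = g z := fun z =>
    (integral_map hZ ((GiniJEL.measurable_h γ).comp
      measurable_prodMk_left).aestronglyMeasurable).symm
  have hpos : 0 < ∫ z, g z ^ 2 ∂μ := by
    rw [← variance_of_integral_eq_zero hgm.aemeasurable hg0, variance_map hgm.aemeasurable hZ]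
    have : (fun ω => GiniJEL.proj P (Z 0) γ (Z 0 ω)) = g ∘ Z 0 := funext fun ω => hproj _
    rw [← this]
    exact hσ
  have hmain := GiniJEL.tendstoInDistribution_neg_two_log_jelRatio hindep hident rfl
    (GiniJEL.measurable_h γ) hhL (GiniJEL.integrable_h γ (hXμ.integrable one_le_two)) hgm
    (fun _ => rfl) (GiniJEL.memLp_integral_h γ hXμ) hg0 hpos
  have hcoe : Measurable fun x : ℝ => (x : EReal) := measurable_coe_real_ereal
  have hlaw : (gaussianReal 0 1).map (fun x : ℝ => ((x ^ 2 : ℝ) : EReal))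
      = GiniJEL.chiSqOne.map fun x : ℝ => (x : EReal) :=
    (Measure.map_map hcoe (by fun_prop)).symm
  refine ⟨hmain.forall_aemeasurable, hcoe.aemeasurable, ?_⟩
  have := hmain.tendsto
  simp only [hlaw] at this
  exact this
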